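/- Let $d\ge 2$ and let $A\subset\mathbb{R}^d$ have positive reach, i.e. $\inf_{a\in A}\operatorname{reach}(A,a)>0$, where $\operatorname{reach}(A,a)$ is the supremum of all $r\ge 0$ such that every point of the open ball $B(a,r)$ (with $B(a,0)=\emptyset$) has exactly one nearest point in $A$. For $x\in A$ let $\operatorname{Tan}(A,x)$ be the tangent cone of $A$ at $x$, that is, the set consisting of $0$ and of all limits $\lim_{i\to\infty} r_i(x_i-x)$ with $r_i>0$, $x\ne x_i\in A$ and $x_i\to x$. Let $T_1(A)$ be the set of all $x\in A$ such that $\operatorname{Tan}(A,x)$ has dimension $1$ (i.e. its linear span is one-dimensional), and let $T_1^+(A)$ be the set of all $x\in T_1(A)$ such that $\operatorname{Tan}(A,x)$ equals its linear span, i.e. is a line. A $1$-dimensional $C^{1,1}$ surface in $\mathbb{R}^d$ is a set of the form $\{w+\varphi(w):\ w\in W\}$, where $W\subset\mathbb{R}^d$ is a one-dimensional linear subspace and $\varphi:W\to W^\perp$ is a (Fréchet) differentiable mapping whose derivative is Lipschitz on $W$. Then for every $a\in T_1^+(A)$ there exist a $1$-dimensional $C^{1,1}$ surface $\Gamma$ and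 a $\delta>0$ such that $$T_1(A)\cap B(a,\delta)\subset \Gamma\cap B(a,\delta)\subset A,$$ where $B(a,\delta)$ is the open ball with center $a$ and radius $\delta$. -/

import Mathlib

open Filter Topology
open scoped ENNReal NNReal

namespace PosReach

noncomputable section

section Reach

variable {X : Type*} [MetricSpace X]

/-- The multivalued metric projection: the set of points of `A` that are nearest to `z`. -/
def nearestPoints (A : Set X) (z : X) : Set X :=
  {a | a ∈ A ∧ dist z a = Metric.infDist z A}

/-- The set of all points that have exactly one nearest point in `A`. -/
def unp (A : Set X) : Set X :=
  {z | ∃! a, a ∈ nearestPoints A z}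

/-- The local reach of `A` at `a`: the supremum of all radii `r ≥ 0` such that the open ball
with center `a` and radius `r` (empty for `r = 0`) is contained in `unp A`. It may be `∞`. -/
def reachAt (A : Set X) (a : X) : ℝ≥0∞ :=
  ⨆ (r : ℝ≥0) (_ : Metric.ball a (r : ℝ) ⊆ unp A), (r : ℝ≥0∞)

/-- The reach of `A`: the infimum of the local reach over the points of `A`. -/
def reach (A : Set X) : ℝ≥0∞ :=
  ⨅ a ∈ A, reachAt A a

/-- `A` has positive reach. -/
def HasPositiveReach (A : Set X) : Prop :=
  0 < reach A

end Reach

section Tangent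

variable {E : Type*} [NormedAddCommGroup E] [NormedSpace ℝ E]

/-- The tangent cone of `A` at `a`: the vector `0`, and all limits of `rᵢ (aᵢ - a)` with
`a ≠ aᵢ ∈ A`, `aᵢ → a` and `rᵢ > 0`. -/
def tanCone (A : Set E) (a : E) : Set E :=
  {u | u = 0 ∨ ∃ (x : ℕ → E) (r : ℕ → ℝ), (∀ i, x i ∈ A ∧ x i ≠ a) ∧ (∀ i, 0 < r i) ∧
    Tendsto x atTop (𝓝 a) ∧ Tendsto (fun i => r i • (x i - a)) atTop (𝓝 u)}

/-- The set of points of `A` at which the tangent cone has dimension `k`. The tangent cones of a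
set with positive reach are convex, and the dimension of a convex cone is that of its span. -/
def T (k : ℕ) (A : Set E) : Set E :=
  {x | x ∈ A ∧ Module.finrank ℝ (Submodule.span ℝ (tanCone A x)) = k}

/-- The set of points of `A` at which the tangent cone is a `k`-dimensional linear subspace. -/
def TPlus (k : ℕ) (A : Set E) : Set E :=
  {x | x ∈ T k A ∧ (Submodule.span ℝ (tanCone A x) : Set E) = tanCone A x}

end Tangent

/-- A mapping between normed spaces, defined everywhere, is `C^{1,1}` smooth if it is Fréchet
differentiable and its derivative is Lipschitz. -/
def IsC11 {E F : Type*} [NormedAddCommGroup E] [NormedSpace ℝ E]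
    [NormedAddCommGroup F] [NormedSpace ℝ F] (f : E → F) : Prop :=
  Differentiable ℝ f ∧ ∃ K : ℝ≥0, LipschitzWith K (fderiv ℝ f)

/-- `Γ` is a `k`-dimensional `C^{1,1}` surface: the graph of a `C^{1,1}` mapping from a
`k`-dimensional linear subspace (with `k` positive and less than the dimension of the ambient
space) to its orthogonal complement. -/
def IsC11Surface {E : Type*} [NormedAddCommGroup E] [InnerProductSpace ℝ E]
    (k : ℕ) (Γ : Set E) : Prop :=
  0 < k ∧ k < Module.finrank ℝ E ∧
    ∃ (W : Submodule ℝ E) (φ : W → Wᗮ), Module.finrank ℝ W = k ∧ IsC11 φ ∧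
      Γ = {x | ∃ w : W, x = (w : E) + (φ w : E)}

end

end PosReach

/-! ### Metric projection onto a set of positive reach, Federer's inequality, tangent approximation
-/

namespace PosReach

/-! Positive reach gives a radius `r` such that every point closer than `r` to `A` has a unique
foot. Uniqueness and compactness make feet continuous, and maximizing the distance to `A` on small
balls shows that a point can be pushed straight away from its foot, up to distance `r`, without
losing that foot. This is Federer's inequality (`inner_normal_le`). It makes the projection
Lipschitz near `A`, and it puts a point of a short segment between two points of `A` within a
quadratic error of `A` (`dist_segment_le`). It also bounds quadratically the deviation of `A` from
its tangent cone.

Let the tangent cone at `a` be the line of a unit vector `e`. Since `e` and `-e` are both tangent,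
`A` continues on both sides of `a`, and projecting segments shows that the slices of `A` by
hyperplanes orthogonal to `e` are nonempty and vary in a Lipschitz way near `a`
(`exists_local_level`). Midpoints of points in two slices are quadratically close to the middle
slice. The slices need not be single points, so a `C^{1,1}` selection has to be built. On a grid of
`N` steps, take a chain through the slices of least discrete energy. Moving one vertex towards the
midpoint of its neighbours cannot lower the energy, so second differences are bounded by squared
steps (`exists_discrete_selection`). These bounds survive as `N` tends to infinity and give a curve
inside `A` (`exists_C11_curve`), whose graph over the tangent line is `Γ`.

A nearby point of `T 1 A` is alone in its slice: there `A` clings to a line which is transverse to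
the slice, because `A` also has points further along `e` (`exists_fibre_unique`). Such a point
therefore lies on the curve. -/

theorem HasPositiveReach.exists_radius {X : Type*} [MetricSpace X] {A : Set X}
    (hA : HasPositiveReach A) (hne : A.Nonempty) :
    ∃ r : ℝ, 0 < r ∧ ∀ z, Metric.infDist z A < r → z ∈ unp A := by
  obtain ⟨r, hr0, hr⟩ := ENNReal.lt_iff_exists_nnreal_btwn.1 hA
  refine ⟨r, by exact_mod_cast hr0, fun z hz => ?_⟩
  obtain ⟨y, hy, hzy⟩ := (Metric.infDist_lt_iff hne).1 hz
  have h1 : (r : ℝ≥0∞) < reachAt A y := hr.trans_le (iInf₂_le y hy)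
  simp only [reachAt, lt_iSup_iff] at h1
  obtain ⟨s, hs, hrs⟩ := h1
  have hrs' : (r : ℝ) < s := by exact_mod_cast hrs
  exact hs (Metric.mem_ball.2 (hzy.trans hrs'))

theorem isClosed_of_unp {X : Type*} [MetricSpace X] {A : Set X} {r : ℝ} (hr : 0 < r)
    (hU : ∀ z, Metric.infDist z A < r → z ∈ unp A) : IsClosed A := by
  refine isClosed_of_closure_subset fun z hz => ?_
  have h0 : Metric.infDist z A = 0 := Metric.infDist_zero_of_mem_closure hz
  obtain ⟨p, ⟨hp, hzp⟩, -⟩ := hU z (by rw [h0]; exact hr)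
  rw [h0, dist_eq_zero] at hzp
  exact hzp ▸ hp

theorem mem_nearestPoints_iff {X : Type*} [MetricSpace X] {A : Set X} {z p : X} :
    p ∈ nearestPoints A z ↔ p ∈ A ∧ ∀ y ∈ A, dist z p ≤ dist z y := by
  constructor
  · rintro ⟨hp, h⟩
    exact ⟨hp, fun y hy => h ▸ Metric.infDist_le_dist_of_mem hy⟩
  · rintro ⟨hp, h⟩
    exact ⟨hp, le_antisymm ((Metric.le_infDist ⟨p, hp⟩).2 fun {y} hy => h y hy)
      (Metric.infDist_le_dist_of_mem hp)⟩

/-- The feet stay bounded, and any subsequential limit is again a foot of `z`, hence equals the only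
one. This continuity replaces differentiability of the distance function. -/
theorem tendsto_nearestPoints {X : Type*} [MetricSpace X] [ProperSpace X] {A : Set X}
    (hc : IsClosed A) {z : X} (hz : z ∈ unp A) {p : X} (hp : p ∈ nearestPoints A z)
    {u q : ℕ → X} (hu : Tendsto u atTop (𝓝 z)) (hq : ∀ k, q k ∈ nearestPoints A (u k)) :
    Tendsto q atTop (𝓝 p) := by
  refine tendsto_of_subseq_tendsto fun ns hns => ?_
  have hun := hu.comp hns
  have hd : Tendsto (fun k => dist (u (ns k)) (q (ns k))) atTop (𝓝 (Metric.infDist z A)) := by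
    simp only [fun k => (hq (ns k)).2]
    exact ((Metric.continuous_infDist_pt A).tendsto z).comp hun
  have hd' : Tendsto (fun k => dist (u (ns k)) z) atTop (𝓝 0) := tendsto_iff_dist_tendsto_zero.1 hun
  have hev : ∀ᶠ k in atTop, q (ns k) ∈ Metric.closedBall z (Metric.infDist z A + 2) := by
    filter_upwards [hd.eventually (gt_mem_nhds (lt_add_one _)),
      hd'.eventually (gt_mem_nhds one_pos)] with k h1 h2
    rw [Metric.mem_closedBall, dist_comm]
    have := dist_triangle z (u (ns k)) (q (ns k))
    rw [dist_comm z (u (ns k))] at this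
    linarith
  obtain ⟨p', -, ms, hms, hlim⟩ := tendsto_subseq_of_frequently_bounded
    (Metric.isBounded_closedBall) hev.frequently
  refine ⟨ms, ?_⟩
  have hp'A : p' ∈ A := hc.mem_of_tendsto hlim (Eventually.of_forall fun k => (hq _).1)
  have hp' : p' ∈ nearestPoints A z := by
    refine ⟨hp'A, tendsto_nhds_unique ?_ (hd.comp hms.tendsto_atTop)⟩
    exact (hun.comp hms.tendsto_atTop).dist hlim
  rw [hz.unique hp hp']
  exact hlim

section Inner

variable {E : Type*} [NormedAddCommGroup E] [InnerProductSpace ℝ E]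

open scoped RealInnerProductSpace

theorem inner_lt_one_of_ne {n q : E} (hn : ‖n‖ = 1) (hq : ‖q‖ ≤ 1) (h : n ≠ q) : ⟪n, q⟫ < 1 := by
  have h1 : 0 < ‖n - q‖ ^ 2 := by
    have := norm_pos_iff.2 (sub_ne_zero.2 h)
    positivity
  rw [norm_sub_sq_real, hn] at h1
  nlinarith [norm_nonneg q]

variable [ProperSpace E] {A : Set E} {r : ℝ}

omit [InnerProductSpace ℝ E] in
theorem exists_nearest (hr : 0 < r) (hU : ∀ z, Metric.infDist z A < r → z ∈ unp A)
    (hne : A.Nonempty) (z : E) : ∃ p, p ∈ nearestPoints A z := by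
  obtain ⟨p, hp, h⟩ := (isClosed_of_unp hr hU).exists_infDist_eq_dist hne z
  exact ⟨p, hp, h.symm⟩

/-- At a point maximizing the distance to `A` on a closed ball, the distance grows in the radial
direction. -/
theorem radial_of_isMaxOn (hr : 0 < r) (hU : ∀ z, Metric.infDist z A < r → z ∈ unp A)
    {z z' p' : E} {ε : ℝ} (hε : 0 < ε) (hz' : z' ∈ Metric.closedBall z ε)
    (hmax : ∀ y ∈ Metric.closedBall z ε, Metric.infDist y A ≤ Metric.infDist z' A)
    (hp' : p' ∈ nearestPoints A z') (hpos : 0 < ‖z' - p'‖) (hlt : ‖z' - p'‖ < r) :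
    z' - z = (ε / ‖z' - p'‖) • (z' - p') := by
  set D := ‖z' - p'‖ with hD
  have hDinf : Metric.infDist z' A = D := by rw [← hp'.2, dist_eq_norm]
  by_contra hcon
  set n := D⁻¹ • (z' - p') with hn
  set q := ε⁻¹ • (z' - z) with hq
  have hn1 : ‖n‖ = 1 := by
    rw [hn, norm_smul, norm_inv, Real.norm_eq_abs, abs_of_pos hpos, ← hD, inv_mul_cancel₀ hpos.ne']
  have hq1 : ‖q‖ ≤ 1 := by
    rw [hq, norm_smul, norm_inv, Real.norm_eq_abs, abs_of_pos hε]
    rw [Metric.mem_closedBall, dist_eq_norm] at hz'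
    rw [inv_mul_le_iff₀ hε]; linarith
  have hzq : z' = z + ε • q := by rw [hq, smul_inv_smul₀ hε.ne']; abel
  have hzn : z' - p' = D • n := by rw [hn, smul_inv_smul₀ hpos.ne']
  have hne : n ≠ q := by
    intro h
    apply hcon
    rw [hzn, smul_smul, div_mul_cancel₀ _ hpos.ne', h, hzq]; abel
  have hu : 0 < ⟪z' - p', n - q⟫ := by
    rw [hzn, real_inner_smul_left, inner_sub_right, real_inner_self_eq_norm_sq, hn1]
    have := inner_lt_one_of_ne hn1 hq1 hne
    apply mul_pos hpos; linarith
  set τ : ℕ → ℝ := fun k => 1 / ((k : ℝ) + 1) with hτ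
  have hτ0 : ∀ k, 0 < τ k := fun k => by positivity
  have hτ1 : ∀ k, τ k ≤ 1 := fun k => by
    rw [hτ]; simp only; rw [div_le_one (by positivity)]; linarith [(Nat.cast_nonneg k : (0 : ℝ) ≤ k)]
  have hτlim : Tendsto τ atTop (𝓝 0) := tendsto_one_div_add_atTop_nhds_zero_nat
  -- Test points move from `z'` towards `z + ε • n`. They stay in the ball by convexity, and if `n ≠
  -- q` the distance to `A` would grow to first order.
  set u : ℕ → E := fun k => z' + (τ k * ε) • (n - q) with hu_def
  have hulim : Tendsto u atTop (𝓝 z') := by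
    have : Tendsto u atTop (𝓝 (z' + ((0 : ℝ) * ε) • (n - q))) :=
      tendsto_const_nhds.add ((hτlim.mul_const ε).smul_const _)
    simpa using this
  have hub : ∀ k, u k ∈ Metric.closedBall z ε := fun k => by
    have h1 : u k - z = ε • ((1 - τ k) • q + τ k • n) := by
      simp only [hu_def]; rw [hzq]; module
    rw [Metric.mem_closedBall, dist_eq_norm, h1, norm_smul, Real.norm_eq_abs, abs_of_pos hε]
    have h2 : ‖(1 - τ k) • q + τ k • n‖ ≤ 1 := by
      refine (norm_add_le _ _).trans ?_
      rw [norm_smul (1 - τ k), norm_smul (τ k), hn1, Real.norm_eq_abs, Real.norm_eq_abs, abs_of_pos (hτ0 k),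
        abs_of_nonneg (by linarith [hτ1 k])]
      nlinarith [hτ1 k]
    nlinarith
  have hAne : A.Nonempty := ⟨p', hp'.1⟩
  choose P hP using fun k => exists_nearest hr hU hAne (u k)
  have hPlim : Tendsto P atTop (𝓝 p') := tendsto_nearestPoints (isClosed_of_unp hr hU)
    (hU z' (by rw [hDinf]; exact hlt)) hp' hulim hP
  have hle : ∀ k, ⟪z' - P k, n - q⟫ ≤ 0 := fun k => by
    have h1 : ‖u k - P k‖ ≤ D := by
      rw [← dist_eq_norm, (hP k).2, ← hDinf]; exact hmax _ (hub k)
    have h2 : D ≤ ‖z' - P k‖ := by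
      rw [← hDinf, ← dist_eq_norm]; exact Metric.infDist_le_dist_of_mem (hP k).1
    have h3 : u k - P k = (z' - P k) + (τ k * ε) • (n - q) := by simp only [hu_def]; abel
    have h4 : ‖u k - P k‖ ^ 2 ≤ ‖z' - P k‖ ^ 2 := by gcongr; exact h1.trans h2
    rw [h3, norm_add_sq_real, real_inner_smul_right] at h4
    have h5 : 0 < τ k * ε := mul_pos (hτ0 k) hε
    by_contra! h6
    nlinarith [mul_pos h5 h6, sq_nonneg ‖(τ k * ε) • (n - q)‖]
  have hlim : Tendsto (fun k => ⟪z' - P k, n - q⟫) atTop (𝓝 ⟪z' - p', n - q⟫) :=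
    (tendsto_const_nhds.sub hPlim).inner tendsto_const_nhds
  exact absurd (le_of_tendsto' hlim hle) (not_le.2 hu)

/-- Moving away from the nearest point keeps that point nearest. -/
theorem nearest_push (hr : 0 < r) (hU : ∀ z, Metric.infDist z A < r → z ∈ unp A)
    {x n : E} {d ε : ℝ} (hn : ‖n‖ = 1) (hd : 0 < d) (hε : 0 < ε) (hεd : ε ≤ d) (hdr : d + ε < r)
    (hx : x ∈ nearestPoints A (x + d • n)) : x ∈ nearestPoints A (x + (d + ε) • n) := by
  set z := x + d • n with hz
  have hnorm : ∀ t : ℝ, 0 ≤ t → dist (x + t • n) x = t := fun t ht => by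
    rw [dist_eq_norm, add_sub_cancel_left, norm_smul, hn, Real.norm_eq_abs, abs_of_nonneg ht,
      mul_one]
  have hzx : Metric.infDist z A = d := by rw [← hx.2]; exact hnorm d hd.le
  obtain ⟨z', hz', hmax⟩ := (isCompact_closedBall z ε).exists_isMaxOn
    ⟨z, Metric.mem_closedBall_self hε.le⟩ (Metric.continuous_infDist_pt A).continuousOn
  obtain ⟨p', hp'⟩ := exists_nearest hr hU ⟨x, hx.1⟩ z'
  have hDinf : Metric.infDist z' A = ‖z' - p'‖ := by rw [← hp'.2, dist_eq_norm]
  have hdD : d ≤ ‖z' - p'‖ := by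
    rw [← hDinf, ← hzx]; exact hmax (Metric.mem_closedBall_self hε.le)
  have hDd : ‖z' - p'‖ ≤ d + ε := by
    rw [← hDinf, ← hzx]
    have := Metric.infDist_le_infDist_add_dist (s := A) (x := z') (y := z)
    rw [Metric.mem_closedBall] at hz'
    linarith
  have hpos : 0 < ‖z' - p'‖ := hd.trans_le hdD
  have hrad := radial_of_isMaxOn hr hU hε hz' (fun y hy => hmax hy) hp' hpos (hDd.trans_lt hdr)
  set D := ‖z' - p'‖ with hD
  -- By radiality `z` lies on the segment from `p'` to `z'`, so `p'` is at distance `D - ε` from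
  -- `z`. This is at least `d`, while `D ≤ d + ε`. Equality follows, so `p'` is a foot of `z` and
  -- must be `x`.
  have hzp : z - p' = (1 - ε / D) • (z' - p') := by
    rw [sub_smul, one_smul, ← hrad]; abel
  have hcoef : 0 ≤ 1 - ε / D := by rw [sub_nonneg, div_le_one hpos]; linarith
  have hzp' : dist z p' = D - ε := by
    rw [dist_eq_norm, hzp, norm_smul, Real.norm_eq_abs, abs_of_nonneg hcoef, ← hD]
    field_simp
  have hge : d ≤ dist z p' := by rw [← hzx]; exact Metric.infDist_le_dist_of_mem hp'.1
  have hDeq : D = d + ε := by linarith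
  have hp'z : p' ∈ nearestPoints A z := ⟨hp'.1, by rw [hzx, hzp']; linarith⟩
  have hpx : p' = x := (hU z (by rw [hzx]; linarith)).unique hp'z hx
  subst hpx
  have hz'eq : z' = p' + (d + ε) • n := by
    have h1 : d • n = (1 - ε / D) • (z' - p') := by rw [← hzp, hz]; abel
    have h2 : 1 - ε / D = d / (d + ε) := by rw [hDeq]; field_simp; ring
    rw [h2] at h1
    have h3 : ((d + ε) / d) • (d • n) = z' - p' := by
      have : (d + ε) / d * (d / (d + ε)) = 1 := by field_simp
      rw [h1, smul_smul, this, one_smul]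
    rw [smul_smul, div_mul_cancel₀ _ hd.ne'] at h3
    rw [h3]; abel
  rw [← hz'eq]; exact hp'

omit [ProperSpace E] in
-- Squaring the distances makes the condition affine in `t`, so the admissible `t` form a closed
-- set.
theorem mem_nearestPoints_add_smul_iff {x n : E} {t : ℝ} (hx : x ∈ A) :
    x ∈ nearestPoints A (x + t • n) ↔ ∀ y ∈ A, 2 * t * ⟪n, y - x⟫ ≤ ‖y - x‖ ^ 2 := by
  rw [mem_nearestPoints_iff, and_iff_right hx]
  refine forall₂_congr fun y _ => ?_
  rw [dist_eq_norm, dist_eq_norm, ← sq_le_sq₀ (norm_nonneg _) (norm_nonneg _)]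
  have h1 : x + t • n - x = t • n := by abel
  have h2 : x + t • n - y = t • n - (y - x) := by abel
  rw [h1, h2, norm_sub_sq_real, real_inner_smul_left]
  constructor <;> intro h <;> linarith

/-- Federer's inequality for proximal normals of a set whose reach is at least `r`. -/
theorem inner_normal_le (hr : 0 < r) (hU : ∀ z, Metric.infDist z A < r → z ∈ unp A)
    {z x y : E} (hx : x ∈ nearestPoints A z) (hlt : ‖z - x‖ < r) (hy : y ∈ A) :
    2 * r * ⟪z - x, y - x⟫ ≤ ‖z - x‖ * ‖y - x‖ ^ 2 := by
  rcases (norm_nonneg (z - x)).eq_or_lt with h0 | hd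
  · rw [eq_comm, norm_eq_zero] at h0
    simp [h0]
  set d := ‖z - x‖ with hd_def
  set n := d⁻¹ • (z - x) with hn
  have hn1 : ‖n‖ = 1 := by
    rw [hn, norm_smul, norm_inv, Real.norm_eq_abs, abs_of_pos hd, ← hd_def, inv_mul_cancel₀ hd.ne']
  have hzn : z - x = d • n := by rw [hn, smul_inv_smul₀ hd.ne']
  have hz : z = x + d • n := by rw [← hzn]; abel
  set S : Set ℝ := {t | ∀ y ∈ A, 2 * t * ⟪n, y - x⟫ ≤ ‖y - x‖ ^ 2} with hS
  have hSc : IsClosed S := by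
    simp only [hS, Set.ofPred_forall]
    exact isClosed_biInter fun y _ => isClosed_le (by fun_prop) continuous_const
  -- Continuous induction: the set is closed, and `nearest_push` moves beyond any `t < r`.
  -- Closedness then includes `t = r` itself, which gives the sharp constant.
  have hsub : Set.Icc d r ⊆ S := by
    refine IsClosed.Icc_subset_of_forall_exists_gt (hSc.inter isClosed_Icc) ?_ ?_
    · rw [hz] at hx
      exact (mem_nearestPoints_add_smul_iff hx.1).1 hx
    · rintro t ⟨htS, htd, htr⟩ b (hb : t < b)
      have ht0 : 0 < t := hd.trans_le htd
      set ε := min (min t (b - t)) ((r - t) / 2) with hε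
      have hε0 : 0 < ε := lt_min (lt_min ht0 (by linarith)) (by linarith)
      have h1 : ε ≤ t := (min_le_left _ _).trans (min_le_left _ _)
      have h2 : ε ≤ b - t := (min_le_left _ _).trans (min_le_right _ _)
      have h3 : ε ≤ (r - t) / 2 := min_le_right _ _
      refine ⟨t + ε, ?_, by linarith, by linarith⟩
      exact (mem_nearestPoints_add_smul_iff hx.1).1
        (nearest_push hr hU hn1 ht0 hε0 h1 (by linarith)
          ((mem_nearestPoints_add_smul_iff hx.1).2 htS))
  have := hsub (Set.right_mem_Icc.2 hlt.le) y hy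
  rw [hzn, real_inner_smul_left]
  nlinarith

/-- Adding Federer's inequality at the two feet shows that the projection is monotone up to an
error. Normals of length at most `r / 2` keep that error at half of `‖p - p'‖ ^ 2`, which can be
absorbed. -/
theorem nearest_lipschitz (hr : 0 < r) (hU : ∀ z, Metric.infDist z A < r → z ∈ unp A)
    {z z' p p' : E} (hp : p ∈ nearestPoints A z) (hp' : p' ∈ nearestPoints A z')
    (h : ‖z - p‖ ≤ r / 2) (h' : ‖z' - p'‖ ≤ r / 2) : ‖p - p'‖ ≤ 2 * ‖z - z'‖ := by
  have h1 := inner_normal_le hr hU hp (by linarith) hp'.1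
  have h2 := inner_normal_le hr hU hp' (by linarith) hp.1
  have h3 : ⟪z - p, p' - p⟫ + ⟪z' - p', p - p'⟫ = ‖p - p'‖ ^ 2 - ⟪z - z', p - p'⟫ := by
    rw [← real_inner_self_eq_norm_sq]
    simp only [inner_sub_left, inner_sub_right]; ring
  have h4 := real_inner_le_norm (z - z') (p - p')
  rw [norm_sub_rev p' p] at h1
  have h5 : 2 * r * (‖p - p'‖ ^ 2 - ⟪z - z', p - p'⟫) ≤ r * ‖p - p'‖ ^ 2 := by
    rw [← h3]; nlinarith [sq_nonneg ‖p - p'‖]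
  have h6 : ‖p - p'‖ ^ 2 ≤ 2 * (‖z - z'‖ * ‖p - p'‖) := by
    have : r * ‖p - p'‖ ^ 2 ≤ r * (2 * (‖z - z'‖ * ‖p - p'‖)) := by nlinarith
    exact le_of_mul_le_mul_left this hr
  rcases (norm_nonneg (p - p')).eq_or_lt with h0 | h0
  · rw [← h0]; positivity
  · exact le_of_mul_le_mul_right (by nlinarith) h0

omit [ProperSpace E] in
theorem norm_sub_nearest_le_of_segment {x b p : E} {t : ℝ} (ht : t ∈ Set.Icc (0 : ℝ) 1)
    (hx : x ∈ A) (hb : b ∈ A) (hxb : ‖b - x‖ ≤ r)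
    (hp : p ∈ nearestPoints A (x + t • (b - x))) : ‖x + t • (b - x) - p‖ ≤ r / 2 := by
  rw [mem_nearestPoints_iff] at hp
  have h1 := hp.2 x hx
  have h2 := hp.2 b hb
  rw [dist_eq_norm, dist_eq_norm] at h1 h2
  have e1 : x + t • (b - x) - x = t • (b - x) := by abel
  have e2 : x + t • (b - x) - b = (t - 1) • (b - x) := by module
  rw [e1, norm_smul, Real.norm_eq_abs, abs_of_nonneg ht.1] at h1
  rw [e2, norm_smul, Real.norm_eq_abs, abs_of_nonpos (by linarith [ht.2])] at h2
  nlinarith [norm_nonneg (b - x), ht.1, ht.2]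

/-- Federer's inequality at the foot `p` is tested with `x` and `b` and averaged with weights `1 -
t` and `t`. The terms linear in `b - x` cancel. -/
theorem dist_segment_le (hr : 0 < r) (hU : ∀ z, Metric.infDist z A < r → z ∈ unp A)
    {x b p : E} {t : ℝ} (ht : t ∈ Set.Icc (0 : ℝ) 1) (hx : x ∈ A) (hb : b ∈ A) (hxb : ‖b - x‖ ≤ r)
    (hp : p ∈ nearestPoints A (x + t • (b - x))) :
    r * ‖x + t • (b - x) - p‖ ≤ t * (1 - t) * ‖b - x‖ ^ 2 := by
  have hle := norm_sub_nearest_le_of_segment ht hx hb hxb hp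
  set n := x + t • (b - x) - p with hn
  have h1 := inner_normal_le hr hU hp (by rw [← hn]; linarith) hx
  have h2 := inner_normal_le hr hU hp (by rw [← hn]; linarith) hb
  rw [← hn] at h1 h2
  have hxp : x - p = n - t • (b - x) := by rw [hn]; abel
  have hbp : b - p = n + (1 - t) • (b - x) := by rw [hn]; module
  clear_value n
  rw [hxp, inner_sub_right, real_inner_self_eq_norm_sq, real_inner_smul_right, norm_sub_sq_real,
    real_inner_smul_right, norm_smul, mul_pow, Real.norm_eq_abs, sq_abs] at h1
  rw [hbp, inner_add_right, real_inner_self_eq_norm_sq, real_inner_smul_right, norm_add_sq_real,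
    real_inner_smul_right, norm_smul, mul_pow, Real.norm_eq_abs, sq_abs] at h2
  have h3 : 2 * r * ‖n‖ ^ 2 ≤ ‖n‖ * (‖n‖ ^ 2 + t * (1 - t) * ‖b - x‖ ^ 2) := by
    have := add_le_add (mul_le_mul_of_nonneg_left h1 (by linarith [ht.2] : 0 ≤ 1 - t))
      (mul_le_mul_of_nonneg_left h2 ht.1)
    linarith
  rcases (norm_nonneg n).eq_or_lt with h0 | h0
  · rw [← h0, mul_zero]
    have := mul_nonneg ht.1 (by linarith [ht.2] : 0 ≤ 1 - t)
    positivity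
  · have h4 : 2 * r * ‖n‖ ≤ ‖n‖ ^ 2 + t * (1 - t) * ‖b - x‖ ^ 2 :=
      le_of_mul_le_mul_left (by linarith) h0
    nlinarith

/-- The segment from `x` to `b` is projected to `A`; difference quotients of the projection at `x`
stay within `‖b - x‖ ^ 2 / r` of `b - x`, and any cluster point is tangent. -/
theorem exists_tanCone_near (hr : 0 < r) (hU : ∀ z, Metric.infDist z A < r → z ∈ unp A)
    {x b : E} (hx : x ∈ A) (hb : b ∈ A) (hxb : ‖b - x‖ ≤ r) :
    ∃ u ∈ tanCone A x, r * ‖b - x - u‖ ≤ ‖b - x‖ ^ 2 := by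
  set τ : ℕ → ℝ := fun k => 1 / ((k : ℝ) + 1) with hτ
  have hτ0 : ∀ k, 0 < τ k := fun k => by positivity
  have hτ1 : ∀ k, τ k ≤ 1 := fun k => by
    rw [hτ]; simp only; rw [div_le_one (by positivity)]; linarith [(Nat.cast_nonneg k : (0 : ℝ) ≤ k)]
  have hτlim : Tendsto τ atTop (𝓝 0) := tendsto_one_div_add_atTop_nhds_zero_nat
  choose P hP using fun k => exists_nearest hr hU ⟨x, hx⟩ (x + τ k • (b - x))
  set u : ℕ → E := fun k => (τ k)⁻¹ • (P k - x) with hu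
  have hPu : ∀ k, P k = x + τ k • u k := fun k => by
    simp only [hu]; rw [smul_inv_smul₀ (hτ0 k).ne']; abel
  have hub : ∀ k, u k ∈ Metric.closedBall (b - x) (‖b - x‖ ^ 2 / r) := fun k => by
    have h1 := dist_segment_le hr hU ⟨(hτ0 k).le, hτ1 k⟩ hx hb hxb (hP k)
    have h2 : x + τ k • (b - x) - P k = τ k • (b - x - u k) := by rw [hPu k]; module
    rw [h2, norm_smul, Real.norm_eq_abs, abs_of_pos (hτ0 k)] at h1
    rw [mem_closedBall_iff_norm', le_div_iff₀ hr]
    have h3 : ‖b - x - u k‖ * r ≤ (1 - τ k) * ‖b - x‖ ^ 2 :=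
      le_of_mul_le_mul_left (by linarith) (hτ0 k)
    nlinarith [mul_nonneg (hτ0 k).le (sq_nonneg ‖b - x‖)]
  obtain ⟨v, hv, φ, hφ, hlim⟩ := (isCompact_closedBall _ _).tendsto_subseq hub
  refine ⟨v, ?_, ?_⟩
  · by_cases h0 : v = 0
    · exact Or.inl h0
    right
    -- The first `k₀` terms are dropped so that the approximating points differ from `x`.
    obtain ⟨k₀, hk₀⟩ := eventually_atTop.1 (hlim.eventually_ne h0)
    have hlim' := hlim.comp (tendsto_add_atTop_nat k₀)
    have hτ' := (hτlim.comp hφ.tendsto_atTop).comp (tendsto_add_atTop_nat k₀)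
    refine ⟨fun k => P (φ (k + k₀)), fun k => (τ (φ (k + k₀)))⁻¹, fun k => ⟨(hP _).1, ?_⟩,
      fun k => inv_pos.2 (hτ0 _), ?_, hlim'⟩
    · intro h
      apply hk₀ (k + k₀) (by omega)
      simp [hu, h]
    · have := tendsto_const_nhds (x := x) |>.add (hτ'.smul hlim')
      rw [zero_smul, add_zero] at this
      refine this.congr fun k => ?_
      simp only [Function.comp]
      exact (hPu _).symm
  · rw [mem_closedBall_iff_norm', le_div_iff₀ hr] at hv
    linarith

end Inner

end PosReach

/-! ### Slices of the set near a point whose tangent cone is a line -/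

namespace PosReach

section Local

variable {E : Type*} [NormedAddCommGroup E] [InnerProductSpace ℝ E]

open scoped RealInnerProductSpace

theorem exists_unit_span_of_mem_T {A : Set E} {x : E} (hx : x ∈ T 1 A) :
    ∃ f : E, ‖f‖ = 1 ∧ (Submodule.span ℝ (tanCone A x) = Submodule.span ℝ {f}) := by
  obtain ⟨v, hv, hspan⟩ := finrank_eq_one_iff'.1 hx.2
  have hv0 : (v : E) ≠ 0 := fun h => hv (Subtype.ext h)
  refine ⟨‖(v : E)‖⁻¹ • (v : E), norm_smul_inv_norm hv0, le_antisymm (fun u hu => ?_) ?_⟩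
  · obtain ⟨c, hc⟩ := hspan ⟨u, hu⟩
    rw [Submodule.mem_span_singleton]
    refine ⟨c * ‖(v : E)‖, ?_⟩
    rw [smul_smul, mul_assoc, mul_inv_cancel₀ (norm_ne_zero_iff.2 hv0), mul_one]
    exact congrArg Subtype.val hc
  · rw [Submodule.span_singleton_le_iff_mem]
    exact Submodule.smul_mem _ _ v.2

theorem exists_smul_of_mem_tanCone {A : Set E} {x f u : E}
    (h : Submodule.span ℝ (tanCone A x) = Submodule.span ℝ {f}) (hu : u ∈ tanCone A x) :
    ∃ c : ℝ, u = c • f := by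
  have := Submodule.subset_span (R := ℝ) hu
  rw [h, SetLike.mem_coe, Submodule.mem_span_singleton] at this
  obtain ⟨c, hc⟩ := this
  exact ⟨c, hc.symm⟩

theorem norm_sub_inner_smul_le {e : E} (he : ‖e‖ = 1) (v : E) (c : ℝ) :
    ‖v - ⟪v, e⟫ • e‖ ≤ ‖v - c • e‖ := by
  refine le_of_sq_le_sq ?_ (norm_nonneg _)
  rw [norm_sub_sq_real, norm_sub_sq_real, real_inner_smul_right, real_inner_smul_right, norm_smul,
    norm_smul, he, mul_pow, mul_pow, Real.norm_eq_abs, Real.norm_eq_abs, sq_abs, sq_abs]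
  nlinarith [sq_nonneg (⟪v, e⟫ - c)]

theorem exists_mem_near_of_mem_tanCone {A : Set E} {a e : E} (he : ‖e‖ = 1)
    (h : e ∈ tanCone A a) {l : ℝ} (hl : 0 < l) :
    ∃ b ∈ A, ‖b - a‖ ≤ l ∧ 0 < ⟪b - a, e⟫ := by
  rcases h with h | ⟨x, c, hx, hc, hxa, hlim⟩
  · rw [h, norm_zero] at he; norm_num at he
  have h1 : Tendsto (fun i => ⟪c i • (x i - a), e⟫) atTop (𝓝 ⟪e, e⟫) := hlim.inner tendsto_const_nhds
  rw [real_inner_self_eq_norm_sq, he] at h1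
  have h2 := h1.eventually (lt_mem_nhds (show (0 : ℝ) < 1 ^ 2 by norm_num))
  have h3 := hxa.eventually (Metric.closedBall_mem_nhds a hl)
  obtain ⟨i, hi2, hi3⟩ := (h2.and h3).exists
  refine ⟨x i, (hx i).1, by rwa [← dist_eq_norm], ?_⟩
  rw [real_inner_smul_left] at hi2
  exact pos_of_mul_pos_right hi2 (hc i).le

variable [ProperSpace E] {A : Set E} {r : ℝ}

theorem norm_sub_projection_le (hr : 0 < r) (hU : ∀ z, Metric.infDist z A < r → z ∈ unp A)
    {x y f : E} (hf : ‖f‖ = 1) (hx : x ∈ A) (hy : y ∈ A) (hxy : ‖y - x‖ ≤ r)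
    (h : Submodule.span ℝ (tanCone A x) = Submodule.span ℝ {f}) :
    r * ‖y - x - ⟪y - x, f⟫ • f‖ ≤ ‖y - x‖ ^ 2 := by
  obtain ⟨u, hu, hle⟩ := exists_tanCone_near hr hU hx hy hxy
  obtain ⟨c, rfl⟩ := exists_smul_of_mem_tanCone h hu
  exact (mul_le_mul_of_nonneg_left (norm_sub_inner_smul_le hf _ c) hr.le).trans hle

theorem norm_sub_le_abs_inner (hr : 0 < r) (hU : ∀ z, Metric.infDist z A < r → z ∈ unp A)
    {x y f : E} (hf : ‖f‖ = 1) (hx : x ∈ A) (hy : y ∈ A) {η : ℝ} (hη : η ≤ 1)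
    (hxy : ‖y - x‖ ≤ η * r)
    (h : Submodule.span ℝ (tanCone A x) = Submodule.span ℝ {f}) :
    (1 - η) * ‖y - x‖ ≤ |⟪y - x, f⟫| := by
  have h1 := norm_sub_projection_le hr hU hf hx hy (by nlinarith) h
  have h2 : ‖y - x‖ ≤ ‖y - x - ⟪y - x, f⟫ • f‖ + |⟪y - x, f⟫| := by
    have := norm_add_le (y - x - ⟪y - x, f⟫ • f) (⟪y - x, f⟫ • f)
    rwa [sub_add_cancel, norm_smul ⟪y - x, f⟫, hf, mul_one, Real.norm_eq_abs] at this
  have h3 : ‖y - x - ⟪y - x, f⟫ • f‖ ≤ η * ‖y - x‖ := by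
    have : r * ‖y - x - ⟪y - x, f⟫ • f‖ ≤ r * (η * ‖y - x‖) := by
      nlinarith [norm_nonneg (y - x)]
    exact le_of_mul_le_mul_left this hr
  linarith

/-- Between two points of `A` joined in a direction close to `e`, every level of `⟪·, e⟫` is
attained on `A` at a controlled distance. -/
theorem exists_mem_level (hr : 0 < r) (hU : ∀ z, Metric.infDist z A < r → z ∈ unp A)
    {p b e : E} (he : ‖e‖ = 1) (hp : p ∈ A) (hb : b ∈ A) (hpb : ‖b - p‖ ≤ r / 10)
    (hdir : 4 / 5 * ‖b - p‖ ≤ ⟪b - p, e⟫) {w : ℝ} (hw : 0 ≤ w) (hwb : w ≤ ⟪b - p, e⟫) :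
    ∃ q ∈ A, ⟪q - p, e⟫ = w ∧ ‖q - p‖ ≤ 2 * w := by
  choose P hP using fun t : ℝ => exists_nearest hr hU ⟨p, hp⟩ (p + t • (b - p))
  have hpb' : ‖b - p‖ ≤ r := by linarith
  have hlip : ContinuousOn P (Set.Icc 0 1) := by
    refine LipschitzOnWith.continuousOn (K := (2 * ‖b - p‖).toNNReal) ?_
    refine LipschitzOnWith.of_dist_le_mul fun s hs t ht => ?_
    rw [dist_eq_norm, Real.dist_eq, Real.coe_toNNReal _ (by positivity)]
    refine (nearest_lipschitz hr hU (hP s) (hP t)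
      (norm_sub_nearest_le_of_segment hs hp hb hpb' (hP s))
      (norm_sub_nearest_le_of_segment ht hp hb hpb' (hP t))).trans (le_of_eq ?_)
    have : p + s • (b - p) - (p + t • (b - p)) = (s - t) • (b - p) := by module
    rw [this, norm_smul, Real.norm_eq_abs]; ring
  have hself : ∀ y ∈ A, ∀ q ∈ nearestPoints A y, q = y := fun y hy q hq => by
    have := hq.2
    rw [Metric.infDist_zero_of_mem hy, dist_eq_zero] at this
    exact this.symm
  have hP0 : P 0 = p := hself p hp _ (by simpa using hP 0)
  have hP1 : P 1 = b := hself b hb _ (by simpa using hP 1)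
  -- The projected segment is a continuous path in `A` from `p` to `b`, so its height above `p`
  -- passes through `w`.
  have hivt := intermediate_value_Icc (f := fun t => ⟪P t - p, e⟫) (zero_le_one' ℝ)
    ((hlip.sub (continuousOn_const (c := p))).inner (𝕜 := ℝ) (continuousOn_const (c := e)))
  obtain ⟨t, ht, htw⟩ := hivt (show w ∈ Set.Icc _ _ by
    simp only [hP0, hP1, sub_self, inner_zero_left]; exact ⟨hw, hwb⟩)
  replace htw : ⟪P t - p, e⟫ = w := htw
  refine ⟨P t, (hP t).1, htw, ?_⟩
  have h1 := dist_segment_le hr hU ht hp hb hpb' (hP t)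
  set n := p + t • (b - p) - P t with hn
  have hPt : P t - p = t • (b - p) - n := by rw [hn]; abel
  have hnb : ‖n‖ ≤ t * (1 / 10) * ‖b - p‖ := by
    have : r * ‖n‖ ≤ r * (t * (1 / 10) * ‖b - p‖) := by
      have h2 : t * (1 - t) * ‖b - p‖ ^ 2 ≤ t * ‖b - p‖ ^ 2 := by
        nlinarith [mul_nonneg (mul_nonneg ht.1 ht.1) (sq_nonneg ‖b - p‖)]
      nlinarith [mul_nonneg ht.1 (norm_nonneg (b - p))]
    exact le_of_mul_le_mul_left this hr
  rw [hPt] at htw ⊢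
  rw [inner_sub_left, real_inner_smul_left] at htw
  have h3 : |⟪n, e⟫| ≤ ‖n‖ := by simpa [he] using abs_real_inner_le_norm n e
  have h4 := norm_sub_le (t • (b - p)) n
  rw [norm_smul, Real.norm_eq_abs, abs_of_nonneg ht.1] at h4
  have h5 := mul_le_mul_of_nonneg_left hdir ht.1
  have h6 := le_abs_self ⟪n, e⟫
  have h7 := mul_nonneg ht.1 (norm_nonneg (b - p))
  linarith

/-- One-sided version of `exists_local_level`. -/
theorem exists_local_level_right (hr : 0 < r) (hU : ∀ z, Metric.infDist z A < r → z ∈ unp A)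
    {a e : E} (he : ‖e‖ = 1) (ha : a ∈ A)
    (hspan : Submodule.span ℝ (tanCone A a) = Submodule.span ℝ {e}) (hmem : e ∈ tanCone A a) :
    ∃ μ : ℝ, 0 < μ ∧ μ ≤ r / 100 ∧ ∃ b ∈ A, ∀ p, ‖p - a‖ ≤ μ →
      0 < ‖b - p‖ ∧ ‖b - p‖ ≤ r / 10 ∧ 4 / 5 * ‖b - p‖ ≤ ⟪b - p, e⟫ ∧ μ ≤ ⟪b - a, e⟫ := by
  obtain ⟨b, hb, hba, hpos⟩ := exists_mem_near_of_mem_tanCone he hmem (show 0 < r / 20 by linarith)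
  have h1 := norm_sub_le_abs_inner hr hU he ha hb (η := 1 / 20) (by norm_num) (by linarith) hspan
  rw [abs_of_pos hpos] at h1
  have hb0 : 0 < ‖b - a‖ := norm_pos_iff.2 fun h => by simp [h] at hpos
  -- A shift of `p` by `‖b - a‖ / 20` leaves `‖b - p‖ ≤ 21/20 ‖b - a‖` and height at least `18/20 ‖b
  -- - a‖`, whose ratio exceeds `4/5`.
  refine ⟨‖b - a‖ / 20, by positivity, by linarith, b, hb, fun p hp => ?_⟩
  have h2 : b - p = (b - a) - (p - a) := by abel
  have h3 : |⟪p - a, e⟫| ≤ ‖p - a‖ := by simpa [he] using abs_real_inner_le_norm (p - a) e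
  have h4 := norm_sub_le (b - a) (p - a)
  have h5 := norm_sub_norm_le (b - a) (p - a)
  have h6 := le_abs_self ⟪p - a, e⟫
  rw [h2, inner_sub_left]
  refine ⟨by linarith, by linarith, by linarith, by linarith⟩

/-- A level above that of `p` is reached by heading for a point of `A` ahead of `a`, a level below
by heading for one behind; this is where both `e` and `-e` must be tangent. -/
theorem exists_local_level (hr : 0 < r) (hU : ∀ z, Metric.infDist z A < r → z ∈ unp A)
    {a e : E} (he : ‖e‖ = 1) (ha : a ∈ A)
    (hspan : Submodule.span ℝ (tanCone A a) = Submodule.span ℝ {e})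
    (hmem : e ∈ tanCone A a) (hmem' : -e ∈ tanCone A a) :
    ∃ μ : ℝ, 0 < μ ∧ μ ≤ r / 100 ∧ ∀ p ∈ A, ‖p - a‖ ≤ μ → ∀ s : ℝ, |s| ≤ μ →
      ∃ q ∈ A, ⟪q - a, e⟫ = s ∧ ‖q - p‖ ≤ 2 * |s - ⟪p - a, e⟫| := by
  obtain ⟨μ₁, hμ₁, hμr₁, b, hb, h₁⟩ := exists_local_level_right hr hU he ha hspan hmem
  have hspan' : Submodule.span ℝ (tanCone A a) = Submodule.span ℝ {-e} := by
    rw [hspan, ← Set.neg_singleton, Submodule.span_neg]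
  obtain ⟨μ₂, hμ₂, hμr₂, b', hb', h₂⟩ := exists_local_level_right hr hU
    (by rw [norm_neg, he]) ha hspan' hmem'
  refine ⟨min μ₁ μ₂, lt_min hμ₁ hμ₂, (min_le_left _ _).trans hμr₁, fun p hp hpa s hs => ?_⟩
  obtain ⟨hs1, hs2⟩ := abs_le.1 hs
  rcases le_total ⟪p - a, e⟫ s with h | h
  · obtain ⟨-, k1, k2, k3⟩ := h₁ p (hpa.trans (min_le_left _ _))
    have k4 : ⟪b - p, e⟫ = ⟪b - a, e⟫ - ⟪p - a, e⟫ := by rw [← inner_sub_left]; congr 1; abel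
    obtain ⟨q, hq, hqw, hqn⟩ := exists_mem_level hr hU he hp hb k1 k2 (w := s - ⟪p - a, e⟫)
      (by linarith) (by linarith [min_le_left μ₁ μ₂])
    refine ⟨q, hq, ?_, by rwa [abs_of_nonneg (by linarith)]⟩
    have k5 : ⟪q - a, e⟫ = ⟪q - p, e⟫ + ⟪p - a, e⟫ := by rw [← inner_add_left]; congr 1; abel
    linarith
  · obtain ⟨-, k1, k2, k3⟩ := h₂ p (hpa.trans (min_le_right _ _))
    have k4 : ⟪b' - p, -e⟫ = ⟪b' - a, -e⟫ + ⟪p - a, e⟫ := by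
      rw [inner_neg_right, inner_neg_right]
      have : ⟪b' - p, e⟫ = ⟪b' - a, e⟫ - ⟪p - a, e⟫ := by rw [← inner_sub_left]; congr 1; abel
      linarith
    obtain ⟨q, hq, hqw, hqn⟩ := exists_mem_level hr hU (by rw [norm_neg, he]) hp hb' k1 k2
      (w := ⟪p - a, e⟫ - s) (by linarith) (by linarith [min_le_right μ₁ μ₂])
    refine ⟨q, hq, ?_, by rwa [abs_sub_comm, abs_of_nonneg (by linarith)]⟩
    have k5 : ⟪q - a, e⟫ = ⟪q - p, e⟫ + ⟪p - a, e⟫ := by rw [← inner_add_left]; congr 1; abel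
    rw [inner_neg_right] at hqw
    linarith

/-- Near a point of `TPlus 1 A`, a point of `T 1 A` is alone in its fibre. -/
theorem exists_fibre_unique (hr : 0 < r) (hU : ∀ z, Metric.infDist z A < r → z ∈ unp A)
    {a e : E} (he : ‖e‖ = 1) (ha : a ∈ A)
    (hspan : Submodule.span ℝ (tanCone A a) = Submodule.span ℝ {e}) (hmem : e ∈ tanCone A a) :
    ∃ μ : ℝ, 0 < μ ∧ ∀ x ∈ T 1 A, ‖x - a‖ ≤ μ → ∀ y ∈ A, ‖y - x‖ ≤ r / 10 →
      ⟪y - x, e⟫ = 0 → y = x := by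
  obtain ⟨μ, hμ, -, b, hb, h⟩ := exists_local_level_right hr hU he ha hspan hmem
  refine ⟨μ, hμ, fun x hx hxa y hy hyx h0 => ?_⟩
  obtain ⟨k0, k1, k2, -⟩ := h x hxa
  obtain ⟨f, hf, hfs⟩ := exists_unit_span_of_mem_T hx
  have small : ∀ y ∈ A, ‖y - x‖ ≤ r / 10 →
      |⟪y - x, e⟫ - ⟪y - x, f⟫ * ⟪f, e⟫| ≤ 1 / 10 * ‖y - x‖ := by
    intro y hy hyx
    have h1 := norm_sub_projection_le hr hU hf hx.1 hy (by linarith) hfs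
    have h2 : ‖y - x - ⟪y - x, f⟫ • f‖ ≤ 1 / 10 * ‖y - x‖ := by
      have : r * ‖y - x - ⟪y - x, f⟫ • f‖ ≤ r * (1 / 10 * ‖y - x‖) := by
        nlinarith [norm_nonneg (y - x)]
      exact le_of_mul_le_mul_left this hr
    have h3 := abs_real_inner_le_norm (y - x - ⟪y - x, f⟫ • f) e
    rw [he, mul_one, inner_sub_left, real_inner_smul_left] at h3
    exact h3.trans h2
  have h1 := abs_le.1 (small b hb k1)
  have h2 := small y hy hyx
  rw [h0, zero_sub, abs_neg, abs_mul] at h2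
  have h3 : |⟪b - x, f⟫| ≤ ‖b - x‖ := by simpa [hf] using abs_real_inner_le_norm (b - x) f
  -- The point `b` forces the tangent line at `x` to be transverse to the slice. A second point `y`
  -- of the slice would have to be nearly parallel to `f` and orthogonal to `e` at once.
  have h4 : 7 / 10 ≤ |⟪f, e⟫| := by
    have h5 : 7 / 10 * ‖b - x‖ ≤ |⟪f, e⟫| * ‖b - x‖ := by
      have := le_abs_self (⟪b - x, f⟫ * ⟪f, e⟫)
      rw [abs_mul] at this
      nlinarith [abs_nonneg ⟪f, e⟫]
    exact le_of_mul_le_mul_right h5 k0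
  have h5 := norm_sub_le_abs_inner hr hU hf hx.1 hy (η := 1 / 10) (by norm_num) (by linarith) hfs
  have h6 : ‖y - x‖ ≤ 0 := by nlinarith [norm_nonneg (y - x)]
  exact sub_eq_zero.1 (norm_le_zero_iff.1 h6)

end Local

end PosReach

/-! ### Discrete selection by energy minimization -/

namespace PosReach

/-- A minimal chain through fibres: steps and second differences are controlled. -/
theorem exists_discrete_selection {E : Type*} [NormedAddCommGroup E] [InnerProductSpace ℝ E]
    {G : ℝ → Set E} {L C : ℝ} (hL : 0 ≤ L) (hC : 0 ≤ C)
    (hcomp : ∀ t ∈ Set.Icc (0 : ℝ) 1, IsCompact (G t)) (hne : (G 0).Nonempty)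
    (hlip : ∀ s ∈ Set.Icc (0 : ℝ) 1, ∀ t ∈ Set.Icc (0 : ℝ) 1, ∀ x ∈ G s,
      ∃ y ∈ G t, ‖y - x‖ ≤ L * |t - s|)
    (hmid : ∀ s ∈ Set.Icc (0 : ℝ) 1, ∀ t ∈ Set.Icc (0 : ℝ) 1, ∀ x ∈ G s, ∀ y ∈ G t,
      ∃ q ∈ G ((s + t) / 2), ‖q - (2⁻¹ : ℝ) • (x + y)‖ ≤ C * ‖y - x‖ ^ 2)
    {N : ℕ} (hN : 0 < N) :
    ∃ X : ℕ → E, (∀ i ≤ N, X i ∈ G (i / N)) ∧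
      (∀ i < N, ‖X (i + 1) - X i‖ ≤ (L + 8 * C * L ^ 2) / N) ∧
      ∀ i, i + 1 < N → ‖(X (i + 2) - X (i + 1)) - (X (i + 1) - X i)‖ ≤
        8 * C * (L + 8 * C * L ^ 2) ^ 2 / N ^ 2 := by
  have hN' : (0 : ℝ) < N := by exact_mod_cast hN
  -- Parameters are frozen at `1` beyond index `N`, so chains are full sequences and Tychonoff's
  -- theorem makes the set of them compact.
  set θ : ℕ → ℝ := fun i => ((min i N : ℕ) : ℝ) / N with hθ
  have hθmem : ∀ i, θ i ∈ Set.Icc (0 : ℝ) 1 := fun i => by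
    refine ⟨by positivity, ?_⟩
    rw [hθ]; simp only; rw [div_le_one hN']
    exact_mod_cast min_le_right i N
  have hθi : ∀ i ≤ N, θ i = i / N := fun i hi => by simp [hθ, hi]
  have hθstep : ∀ i, |θ (i + 1) - θ i| ≤ 1 / N := fun i => by
    rcases Nat.lt_or_ge i N with h | h
    · rw [hθi _ h.le, hθi _ h, ← sub_div]
      push_cast
      rw [add_sub_cancel_left, abs_of_nonneg (by positivity)]
    · have : θ (i + 1) = θ i := by
        simp only [hθ]; rw [min_eq_right h, min_eq_right (Nat.le_succ_of_le h)]
      rw [this, sub_self, abs_zero]; positivity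
  set K : Set (ℕ → E) := Set.pi Set.univ fun i => G (θ i) with hK
  have hKc : IsCompact K := isCompact_univ_pi fun i => hcomp _ (hθmem i)
  obtain ⟨x₀, hx₀⟩ := hne
  choose! f hf using fun i => hlip (θ i) (hθmem i) (θ (i + 1)) (hθmem (i + 1))
  set Y : ℕ → E := fun n => Nat.rec x₀ (fun i y => f i y) n with hY
  have hYs : ∀ i, Y (i + 1) = f i (Y i) := fun i => rfl
  have hYG : ∀ i, Y i ∈ G (θ i) := fun i => by
    induction i with
    | zero => simpa [hθ, hY] using hx₀
    | succ i ih => rw [hYs]; exact (hf i _ ih).1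
  have hYstep : ∀ i, ‖Y (i + 1) - Y i‖ ≤ L / N := fun i => by
    rw [hYs]
    refine (hf i _ (hYG i)).2.trans ?_
    rw [div_eq_mul_one_div]
    exact mul_le_mul_of_nonneg_left (hθstep i) hL
  set energy : (ℕ → E) → ℝ := fun x => ∑ i ∈ Finset.range N, ‖x (i + 1) - x i‖ ^ 2 with henergy
  have hcont : Continuous energy := by
    refine continuous_finsetSum _ fun i _ => ?_
    fun_prop
  obtain ⟨X, hXK, hXmin⟩ := hKc.exists_isMinOn ⟨Y, fun i _ => hYG i⟩ hcont.continuousOn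
  have hXG : ∀ i, X i ∈ G (θ i) := fun i => hXK i (Set.mem_univ i)
  have hE : energy X ≤ L ^ 2 / N := by
    refine (hXmin (show Y ∈ K from fun i _ => hYG i)).trans ?_
    calc energy Y ≤ ∑ _i ∈ Finset.range N, (L / N) ^ 2 :=
          Finset.sum_le_sum fun i _ => pow_le_pow_left₀ (norm_nonneg _) (hYstep i) 2
      _ = L ^ 2 / N := by
          rw [Finset.sum_const, Finset.card_range, nsmul_eq_mul]; field_simp
  set s : ℕ → E := fun i => X (i + 1) - X i with hs
  have hloc : ∀ i, i + 1 < N → ‖s (i + 1) - s i‖ ≤ 2 * C * ‖X (i + 2) - X i‖ ^ 2 := by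
    intro i hi
    have hθm : (θ i + θ (i + 2)) / 2 = θ (i + 1) := by
      rw [hθi i (by omega), hθi (i + 2) (by omega), hθi (i + 1) (by omega)]
      push_cast; field_simp; ring
    obtain ⟨q, hq, hqm⟩ := hmid _ (hθmem i) _ (hθmem (i + 2)) _ (hXG i) _ (hXG (i + 2))
    rw [hθm] at hq
    -- Only one vertex changes, hence only two energy terms. By the parallelogram law, their sum
    -- measures the squared distance of that vertex from the midpoint of its neighbours.
    set Z := Function.update X (i + 1) q with hZ
    have hZK : Z ∈ K := fun j _ => by
      rcases eq_or_ne j (i + 1) with rfl | h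
      · simpa [hZ] using hq
      · simpa [hZ, h] using hXG j
    have hle : energy X ≤ energy Z := hXmin hZK
    have hsplit : ∀ x : ℕ → E, energy x =
        (∑ j ∈ ((Finset.range N).erase (i + 1)).erase i, ‖x (j + 1) - x j‖ ^ 2) +
          ‖x (i + 1) - x i‖ ^ 2 + ‖x (i + 2) - x (i + 1)‖ ^ 2 := fun x => by
      have h1 : i + 1 ∈ Finset.range N := Finset.mem_range.2 hi
      have h2 : i ∈ (Finset.range N).erase (i + 1) :=
        Finset.mem_erase.2 ⟨by omega, Finset.mem_range.2 (by omega)⟩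
      simp only [henergy]
      rw [← Finset.sum_erase_add _ _ h1, ← Finset.sum_erase_add _ _ h2]
    have hsame : ∑ j ∈ ((Finset.range N).erase (i + 1)).erase i, ‖Z (j + 1) - Z j‖ ^ 2 =
        ∑ j ∈ ((Finset.range N).erase (i + 1)).erase i, ‖X (j + 1) - X j‖ ^ 2 := by
      refine Finset.sum_congr rfl fun j hj => ?_
      rw [Finset.mem_erase, Finset.mem_erase] at hj
      have h1 : j + 1 ≠ i + 1 := by omega
      have h2 : j ≠ i + 1 := hj.2.1
      rw [hZ, Function.update_of_ne h1, Function.update_of_ne h2]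
    have hZ0 : Z i = X i := by simp [hZ]
    have hZ1 : Z (i + 1) = q := by simp [hZ]
    have hZ2 : Z (i + 2) = X (i + 2) := by simp [hZ]
    rw [hsplit X, hsplit Z, hsame, hZ0, hZ1, hZ2] at hle
    have hpar : ∀ y : E, ‖y - X i‖ ^ 2 + ‖X (i + 2) - y‖ ^ 2 =
        2 * ‖y - (2⁻¹ : ℝ) • (X i + X (i + 2))‖ ^ 2 + 2⁻¹ * ‖X (i + 2) - X i‖ ^ 2 := fun y => by
      have e1 : y - X i = (y - (2⁻¹ : ℝ) • (X i + X (i + 2))) +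
          (2⁻¹ : ℝ) • (X (i + 2) - X i) := by module
      have e2 : X (i + 2) - y = (2⁻¹ : ℝ) • (X (i + 2) - X i) -
          (y - (2⁻¹ : ℝ) • (X i + X (i + 2))) := by module
      have e3 : ‖X (i + 2) - X i‖ ^ 2 = 4 * ‖(2⁻¹ : ℝ) • (X (i + 2) - X i)‖ ^ 2 := by
        rw [norm_smul, mul_pow]; norm_num; ring
      rw [e3, e1, e2]
      generalize y - (2⁻¹ : ℝ) • (X i + X (i + 2)) = v
      generalize (2⁻¹ : ℝ) • (X (i + 2) - X i) = w
      rw [norm_add_sq_real, norm_sub_sq_real, real_inner_comm]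
      ring
    have h1 : ‖X (i + 1) - (2⁻¹ : ℝ) • (X i + X (i + 2))‖ ≤
        ‖q - (2⁻¹ : ℝ) • (X i + X (i + 2))‖ := by
      have := hpar (X (i + 1))
      have := hpar q
      refine le_of_sq_le_sq ?_ (norm_nonneg _)
      linarith
    have h2 : s (i + 1) - s i =
        (-2 : ℝ) • (X (i + 1) - (2⁻¹ : ℝ) • (X i + X (i + 2))) := by
      simp only [hs]; module
    have h3 : ‖(-2 : ℝ)‖ = 2 := by norm_num
    rw [h2, norm_smul, h3]
    linarith [h1.trans hqm]
  have hloc' : ∀ i, i + 1 < N → ‖s (i + 1) - s i‖ ≤ 4 * C * (‖s i‖ ^ 2 + ‖s (i + 1)‖ ^ 2) := by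
    intro i hi
    refine (hloc i hi).trans ?_
    have h1 : X (i + 2) - X i = s i + s (i + 1) := by simp only [hs]; abel
    have h2 : ‖X (i + 2) - X i‖ ^ 2 ≤ 2 * (‖s i‖ ^ 2 + ‖s (i + 1)‖ ^ 2) := by
      rw [h1]
      have := norm_add_le (s i) (s (i + 1))
      nlinarith [norm_nonneg (s i + s (i + 1)), sq_nonneg (‖s i‖ - ‖s (i + 1)‖)]
    nlinarith
  -- Second differences are bounded by squared steps, so the total variation of the steps is bounded
  -- by the energy, which is `O(1 / N)`.
  have hvar : ∀ i j, i ≤ j → j < N → ‖s i - s j‖ ≤ 8 * C * (L ^ 2 / N) := by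
    intro i j hij hj
    have h1 := dist_le_Ico_sum_dist s hij
    rw [dist_eq_norm] at h1
    refine h1.trans ?_
    have h2 : ∑ k ∈ Finset.Ico i j, dist (s k) (s (k + 1)) ≤
        ∑ k ∈ Finset.range (N - 1), 4 * C * (‖s k‖ ^ 2 + ‖s (k + 1)‖ ^ 2) := by
      refine (Finset.sum_le_sum fun k hk => ?_).trans
        (Finset.sum_le_sum_of_subset_of_nonneg ?_ fun k _ _ => by positivity)
      · rw [Finset.mem_Ico] at hk
        rw [dist_comm, dist_eq_norm]
        exact hloc' k (by omega)
      · intro k hk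
        rw [Finset.mem_Ico] at hk
        exact Finset.mem_range.2 (by omega)
    refine h2.trans ?_
    rw [← Finset.mul_sum, Finset.sum_add_distrib]
    have h3 : ∑ k ∈ Finset.range (N - 1), ‖s k‖ ^ 2 ≤ energy X :=
      Finset.sum_le_sum_of_subset_of_nonneg (Finset.range_mono (by omega))
        fun k _ _ => by positivity
    have h4 : ∑ k ∈ Finset.range (N - 1), ‖s (k + 1)‖ ^ 2 ≤ energy X := by
      have : energy X = ∑ k ∈ Finset.range (N - 1), ‖s (k + 1)‖ ^ 2 + ‖s 0‖ ^ 2 := by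
        rw [← Finset.sum_range_succ' (fun k => ‖s k‖ ^ 2), Nat.sub_add_cancel hN]
      rw [this]
      linarith [sq_nonneg ‖s 0‖]
    nlinarith
  -- Some step is no larger than the root mean square `L / N`; small variation carries this bound to
  -- every step.
  obtain ⟨i₀, hi₀, hsi₀⟩ : ∃ i ∈ Finset.range N, ‖s i‖ ^ 2 ≤ (L / N) ^ 2 := by
    refine Finset.exists_le_of_sum_le ⟨0, Finset.mem_range.2 hN⟩ ?_
    rw [Finset.sum_const, Finset.card_range, nsmul_eq_mul]
    refine hE.trans (le_of_eq ?_)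
    field_simp
  have hsi₀' : ‖s i₀‖ ≤ L / N := le_of_sq_le_sq hsi₀ (by positivity)
  rw [Finset.mem_range] at hi₀
  have hstep : ∀ i < N, ‖s i‖ ≤ (L + 8 * C * L ^ 2) / N := by
    intro i hi
    have h1 : ‖s i - s i₀‖ ≤ 8 * C * (L ^ 2 / N) := by
      rcases le_total i i₀ with h | h
      · exact hvar i i₀ h hi₀
      · rw [norm_sub_rev]; exact hvar i₀ i h hi
    have h2 := norm_sub_norm_le (s i) (s i₀)
    have h3 : (L + 8 * C * L ^ 2) / N = L / N + 8 * C * (L ^ 2 / N) := by ring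
    rw [h3]; linarith
  refine ⟨X, fun i hi => hθi i hi ▸ hXG i, hstep, fun i hi => ?_⟩
  have h1 := hstep i (by omega)
  have h2 := hstep (i + 1) hi
  refine (hloc' i hi).trans ?_
  have h3 : ‖s i‖ ^ 2 ≤ ((L + 8 * C * L ^ 2) / N) ^ 2 := pow_le_pow_left₀ (norm_nonneg _) h1 2
  have h4 : ‖s (i + 1)‖ ^ 2 ≤ ((L + 8 * C * L ^ 2) / N) ^ 2 :=
    pow_le_pow_left₀ (norm_nonneg _) h2 2
  calc 4 * C * (‖s i‖ ^ 2 + ‖s (i + 1)‖ ^ 2)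
      ≤ 4 * C * (((L + 8 * C * L ^ 2) / N) ^ 2 + ((L + 8 * C * L ^ 2) / N) ^ 2) := by gcongr
    _ = _ := by ring

section Chain

variable {E : Type*} [NormedAddCommGroup E] [NormedSpace ℝ E] {X : ℕ → E} {N : ℕ} {c : ℝ}

omit [NormedSpace ℝ E] in
theorem norm_step_sub_step_le
    (h : ∀ i, i + 1 < N → ‖(X (i + 2) - X (i + 1)) - (X (i + 1) - X i)‖ ≤ c)
    {i j : ℕ} (hi : i < N) (hj : j < N) :
    ‖(X (j + 1) - X j) - (X (i + 1) - X i)‖ ≤ c * |(j : ℝ) - i| := by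
  wlog hij : i ≤ j generalizing i j
  · rw [norm_sub_rev, abs_sub_comm]
    exact this hj hi (by omega)
  have h1 := dist_le_Ico_sum_dist (fun i => X (i + 1) - X i) hij
  rw [dist_comm, dist_eq_norm] at h1
  refine h1.trans ?_
  refine (Finset.sum_le_card_nsmul _ _ c fun k hk => ?_).trans (le_of_eq ?_)
  · rw [Finset.mem_Ico] at hk
    rw [dist_comm, dist_eq_norm]
    exact h k (by omega)
  · rw [Nat.card_Ico, nsmul_eq_mul, Nat.cast_sub hij, abs_of_nonneg]
    · ring
    · rw [sub_nonneg]; exact_mod_cast hij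

/-- Forwards, summing step differences costs `c * d ^ 2`. Backwards, the expansion is based at `j`
and its slope is then exchanged for the one at `i`, which costs as much again; hence the factor `2`.
-/
theorem norm_chain_taylor_le (hc : 0 ≤ c)
    (h : ∀ i, i + 1 < N → ‖(X (i + 2) - X (i + 1)) - (X (i + 1) - X i)‖ ≤ c)
    {i j : ℕ} (hi : i < N) (hj : j < N) :
    ‖X j - X i - ((j : ℝ) - i) • (X (i + 1) - X i)‖ ≤ 2 * c * ((j : ℝ) - i) ^ 2 := by
  have key : ∀ i d : ℕ, i + d < N →
      ‖X (i + d) - X i - (d : ℝ) • (X (i + 1) - X i)‖ ≤ c * (d : ℝ) ^ 2 := by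
    intro i d
    induction d with
    | zero => intro _; simp
    | succ d ih =>
      intro hd
      have h1 := ih (by omega)
      have h2 := norm_step_sub_step_le h (i := i) (j := i + d) (by omega) (by omega)
      have h3 : X (i + (d + 1)) - X i - ((d + 1 : ℕ) : ℝ) • (X (i + 1) - X i) =
          (X (i + d) - X i - (d : ℝ) • (X (i + 1) - X i)) +
            ((X (i + d + 1) - X (i + d)) - (X (i + 1) - X i)) := by
        rw [← add_assoc]; push_cast; module
      rw [h3]
      refine (norm_add_le _ _).trans ?_
      push_cast at h2 ⊢
      rw [add_sub_cancel_left, abs_of_nonneg (Nat.cast_nonneg d)] at h2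
      nlinarith [mul_nonneg hc (Nat.cast_nonneg (α := ℝ) d)]
  rcases le_total i j with hij | hij
  · obtain ⟨d, rfl⟩ := Nat.exists_eq_add_of_le hij
    have := key i d hj
    push_cast
    rw [add_sub_cancel_left]
    nlinarith [mul_nonneg hc (sq_nonneg (d : ℝ))]
  · obtain ⟨d, rfl⟩ := Nat.exists_eq_add_of_le hij
    have h1 := key j d hi
    have h2 := norm_step_sub_step_le h hj hi
    have h3 : X j - X (j + d) - ((j : ℝ) - (j + d : ℕ)) • (X (j + d + 1) - X (j + d)) =
        -(X (j + d) - X j - (d : ℝ) • (X (j + 1) - X j)) +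
          (d : ℝ) • ((X (j + d + 1) - X (j + d)) - (X (j + 1) - X j)) := by
      push_cast; module
    rw [h3]
    refine (norm_add_le _ _).trans ?_
    rw [norm_neg, norm_smul, Real.norm_eq_abs, abs_of_nonneg (Nat.cast_nonneg d)]
    push_cast at h2 ⊢
    rw [add_sub_cancel_left, abs_of_nonneg (Nat.cast_nonneg d)] at h2
    nlinarith [mul_le_mul_of_nonneg_left h2 (Nat.cast_nonneg (α := ℝ) d)]

end Chain

end PosReach

/-! ### Passage to the limit and extension to the whole line -/

namespace PosReach

theorem exists_tendsto_ultrafilter {X ι : Type*} [TopologicalSpace X] {K : Set X}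
    (hK : IsCompact K) (U : Ultrafilter ι) {u : ι → X} (hu : ∀ n, u n ∈ K) :
    ∃ x ∈ K, Tendsto u U (𝓝 x) :=
  hK.ultrafilter_le_nhds (U.map u) (by
    rw [le_principal_iff, Ultrafilter.coe_map, mem_map]
    exact Filter.mem_of_superset univ_mem fun n _ => hu n)

/-- Capping the index at `n` keeps its successor within a chain of `n + 1` steps, even at `t = 1`,
and costs at most one grid step. -/
theorem abs_min_floor_div_sub_le {t : ℝ} (ht : t ∈ Set.Icc (0 : ℝ) 1) (n : ℕ) :
    |((min ⌊t * (n + 1)⌋₊ n : ℕ) : ℝ) / (n + 1) - t| ≤ 1 / ((n : ℝ) + 1) := by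
  have hn : (0 : ℝ) < n + 1 := by positivity
  have h0 : 0 ≤ t * (n + 1) := mul_nonneg ht.1 hn.le
  have h1 := Nat.floor_le h0
  have h2 := Nat.lt_floor_add_one (t * (n + 1))
  have h3 : t * (n + 1) ≤ n + 1 := by nlinarith [ht.2]
  have h4 : ((min ⌊t * (n + 1)⌋₊ n : ℕ) : ℝ) / (n + 1) - t =
      ((min ⌊t * (n + 1)⌋₊ n : ℕ) - t * (n + 1)) / (n + 1) := by field_simp
  rw [h4, abs_div, abs_of_pos hn]
  gcongr
  rw [abs_le]
  rcases le_total ⌊t * (n + 1)⌋₊ n with h | h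
  · rw [min_eq_left h]; constructor <;> linarith
  · rw [min_eq_right h]
    have h' : (n : ℝ) ≤ ⌊t * (n + 1)⌋₊ := by exact_mod_cast h
    constructor <;> linarith

/-- A family of fibres which is Lipschitz and midpoint-convex up to a quadratic error has a
selection which is `C^{1,1}` in the sense of a uniform Taylor expansion. -/
theorem exists_C11_selection {E : Type*} [NormedAddCommGroup E] [InnerProductSpace ℝ E]
    [ProperSpace E] {G : ℝ → Set E} {L C : ℝ} (hL : 0 ≤ L) (hC : 0 ≤ C)
    (hcomp : ∀ t ∈ Set.Icc (0 : ℝ) 1, IsCompact (G t)) (hne : (G 0).Nonempty)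
    (hlip : ∀ s ∈ Set.Icc (0 : ℝ) 1, ∀ t ∈ Set.Icc (0 : ℝ) 1, ∀ x ∈ G s,
      ∃ y ∈ G t, ‖y - x‖ ≤ L * |t - s|)
    (hmid : ∀ s ∈ Set.Icc (0 : ℝ) 1, ∀ t ∈ Set.Icc (0 : ℝ) 1, ∀ x ∈ G s, ∀ y ∈ G t,
      ∃ q ∈ G ((s + t) / 2), ‖q - (2⁻¹ : ℝ) • (x + y)‖ ≤ C * ‖y - x‖ ^ 2) :
    ∃ (γ σ : ℝ → E) (K : ℝ), 0 ≤ K ∧ (∀ t ∈ Set.Icc (0 : ℝ) 1, γ t ∈ G t) ∧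
      (∀ s ∈ Set.Icc (0 : ℝ) 1, ∀ t ∈ Set.Icc (0 : ℝ) 1,
        ‖γ t - γ s - (t - s) • σ s‖ ≤ K * (t - s) ^ 2) ∧
      ∀ s ∈ Set.Icc (0 : ℝ) 1, ∀ t ∈ Set.Icc (0 : ℝ) 1, ‖σ t - σ s‖ ≤ K * |t - s| := by
  choose X hXG hXstep hXsec using fun n : ℕ =>
    exists_discrete_selection hL hC hcomp hne hlip hmid n.succ_pos
  set L' := L + 8 * C * L ^ 2 with hL'
  set M := 8 * C * L' ^ 2 with hM
  have hM0 : 0 ≤ M := by positivity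
  set k : ℕ → ℝ → ℕ := fun n t => min ⌊t * (n + 1)⌋₊ n with hk
  have hkn : ∀ n t, k n t < n + 1 := fun n t => Nat.lt_succ_of_le (min_le_right _ _)
  set κ : ℕ → ℝ → ℝ := fun n t => (k n t : ℝ) / (n + 1) with hκ
  have hκmem : ∀ n t, κ n t ∈ Set.Icc (0 : ℝ) 1 := fun n t => by
    refine ⟨by positivity, ?_⟩
    rw [hκ]; simp only; rw [div_le_one (by positivity)]
    exact_mod_cast (hkn n t).le
  -- One ultrafilter yields limits of positions and slopes for all `t` simultaneously, with no
  -- diagonal subsequence.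
  set U : Ultrafilter ℕ := hyperfilter ℕ with hU
  have hUle : (U : Filter ℕ) ≤ atTop := Nat.hyperfilter_le_atTop
  have hκlim : ∀ t ∈ Set.Icc (0 : ℝ) 1, Tendsto (fun n => κ n t) U (𝓝 t) := fun t ht => by
    rw [tendsto_iff_norm_sub_tendsto_zero]
    refine Tendsto.mono_left ?_ hUle
    exact squeeze_zero (fun _ => norm_nonneg _) (fun n => abs_min_floor_div_sub_le ht n)
      tendsto_one_div_add_atTop_nhds_zero_nat
  have hXκ : ∀ n t, X n (k n t) ∈ G (κ n t) := fun n t => by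
    have := hXG n (k n t) (hkn n t).le
    push_cast at this
    exact this
  have hγ : ∀ t, ∃ g, t ∈ Set.Icc (0 : ℝ) 1 →
      g ∈ G t ∧ Tendsto (fun n => X n (k n t)) U (𝓝 g) := fun t => by
    by_cases ht : t ∈ Set.Icc (0 : ℝ) 1
    -- The chain points lie in slices at grid parameters. The Lipschitz property moves them into the
    -- fixed compact `G t` at vanishing cost.
    · choose y hyG hy using fun n => hlip _ (hκmem n t) t ht _ (hXκ n t)
      obtain ⟨g, hg, hlim⟩ := exists_tendsto_ultrafilter (hcomp t ht) U hyG
      refine ⟨g, fun _ => ⟨hg, ?_⟩⟩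
      have h0 : Tendsto (fun n => y n - X n (k n t)) U (𝓝 0) := by
        refine squeeze_zero_norm hy ?_
        have := ((tendsto_const_nhds (x := t)).sub (hκlim t ht)).abs.const_mul L
        simpa using this
      simpa using hlim.sub h0
    · exact ⟨0, fun h => absurd h ht⟩
  choose γ hγ using hγ
  set S : ℕ → ℝ → E := fun n t => ((n : ℝ) + 1) • (X n (k n t + 1) - X n (k n t)) with hS
  have hSb : ∀ t n, S n t ∈ Metric.closedBall (0 : E) L' := fun t n => by
    have hn : (0 : ℝ) < n + 1 := by positivity
    have := hXstep n (k n t) (hkn n t)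
    push_cast at this
    rw [mem_closedBall_zero_iff, norm_smul, Real.norm_eq_abs, abs_of_pos hn]
    rw [le_div_iff₀ hn] at this
    linarith
  choose σ hσmem hσ using fun t =>
    exists_tendsto_ultrafilter (isCompact_closedBall (0 : E) L') U (hSb t)
  refine ⟨γ, σ, 2 * M, by positivity, fun t ht => (hγ t ht).1, fun s hs t ht => ?_,
    fun s hs t ht => ?_⟩
  · have hl := ((hγ t ht).2.sub (hγ s hs).2).sub (((hκlim t ht).sub (hκlim s hs)).smul (hσ s))
    have hr := (((hκlim t ht).sub (hκlim s hs)).pow 2).const_mul (2 * M)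
    refine le_of_tendsto_of_tendsto' hl.norm hr fun n => ?_
    have hn : (0 : ℝ) < n + 1 := by positivity
    have := norm_chain_taylor_le (by positivity) (hXsec n) (hkn n s) (hkn n t)
    push_cast at this
    have e1 : (κ n t - κ n s) • S n s =
        ((k n t : ℝ) - k n s) • (X n (k n s + 1) - X n (k n s)) := by
      simp only [hκ, hS]; rw [smul_smul]; congr 1; field_simp
    rw [e1]
    refine this.trans (le_of_eq ?_)
    simp only [hκ]; field_simp
  · have hl := (hσ t).sub (hσ s)
    have hr := ((hκlim t ht).sub (hκlim s hs)).abs.const_mul M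
    have hlim := le_of_tendsto_of_tendsto' hl.norm hr fun n => by
      have hn : (0 : ℝ) < n + 1 := by positivity
      have := norm_step_sub_step_le (hXsec n) (hkn n s) (hkn n t)
      push_cast at this
      have e1 : S n t - S n s = ((n : ℝ) + 1) •
          ((X n (k n t + 1) - X n (k n t)) - (X n (k n s + 1) - X n (k n s))) := by
        simp only [hS]; rw [← smul_sub]
      have e2 : κ n t - κ n s = ((k n t : ℝ) - k n s) / (n + 1) := by
        simp only [hκ]; rw [sub_div]
      rw [e1, e2, norm_smul, Real.norm_eq_abs, abs_of_pos hn, abs_div, abs_of_pos hn]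
      refine (mul_le_mul_of_nonneg_left this hn.le).trans (le_of_eq ?_)
      field_simp
    nlinarith [abs_nonneg (t - s)]

theorem hasDerivAt_of_quadratic_bound {E : Type*} [NormedAddCommGroup E] [NormedSpace ℝ E]
    {γ : ℝ → E} {v : E} {s K : ℝ} (h : ∀ t, ‖γ t - γ s - (t - s) • v‖ ≤ K * (t - s) ^ 2) :
    HasDerivAt γ v s := by
  rw [hasDerivAt_iff_isLittleO]
  have h1 : (fun t => γ t - γ s - (t - s) • v) =O[𝓝 s] fun t => (t - s) ^ 2 :=
    Asymptotics.IsBigO.of_bound K (Eventually.of_forall fun t => by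
      rw [Real.norm_eq_abs, abs_of_nonneg (sq_nonneg _)]; exact h t)
  refine h1.trans_isLittleO ?_
  refine (Asymptotics.isLittleO_pow_sub_sub s one_lt_two).congr_left fun t => ?_
  rw [Real.norm_eq_abs, sq_abs]

/-- Extension of a `C^{1,1}` curve from a unit interval to the whole line. -/
theorem exists_C11_extension {E : Type*} [NormedAddCommGroup E] [NormedSpace ℝ E]
    {γ σ : ℝ → E} {K : ℝ} (hK : 0 ≤ K)
    (hγ : ∀ s ∈ Set.Icc (0 : ℝ) 1, ∀ t ∈ Set.Icc (0 : ℝ) 1,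
        ‖γ t - γ s - (t - s) • σ s‖ ≤ K * (t - s) ^ 2)
    (hσ : ∀ s ∈ Set.Icc (0 : ℝ) 1, ∀ t ∈ Set.Icc (0 : ℝ) 1, ‖σ t - σ s‖ ≤ K * |t - s|) :
    ∃ γ' σ' : ℝ → E, (∀ t ∈ Set.Icc (0 : ℝ) 1, γ' t = γ t) ∧
      (∀ t, HasDerivAt γ' (σ' t) t) ∧ LipschitzWith K.toNNReal σ' := by
  -- Outside the interval the curve follows its tangent line at the nearer endpoint.
  set c : ℝ → ℝ := fun t => max 0 (min t 1) with hc
  have hcmem : ∀ t, c t ∈ Set.Icc (0 : ℝ) 1 := fun t =>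
    ⟨le_max_left _ _, max_le zero_le_one (min_le_right _ _)⟩
  have hcid : ∀ t ∈ Set.Icc (0 : ℝ) 1, c t = t := fun t ht => by
    simp only [hc]; rw [min_eq_left ht.2, max_eq_right ht.1]
  have hclip : ∀ s t, |c t - c s| ≤ |t - s| := fun s t => by
    simp only [hc]
    refine (abs_max_sub_max_le_max _ _ _ _).trans ?_
    rw [sub_self, abs_zero]
    refine max_le (abs_nonneg _) ((abs_min_sub_min_le_max _ _ _ _).trans ?_)
    rw [sub_self, abs_zero]
    exact max_le le_rfl (abs_nonneg _)
  -- The first factor vanishes for `t` in the interval, the second when `s` and `t` are beyond the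
  -- same end; otherwise `|t - c t| ≤ |t - s|`.
  have hcprod : ∀ s t, |t - c t| * |c t - c s| ≤ (t - s) ^ 2 := fun s t => by
    rcases lt_or_ge t 0 with h0 | h0
    · have e1 : c t = 0 := by
        simp only [hc]; rw [min_eq_left (by linarith), max_eq_left h0.le]
      rcases lt_or_ge s 0 with h1 | h1
      · have e2 : c s = 0 := by
          simp only [hc]; rw [min_eq_left (by linarith), max_eq_left h1.le]
        rw [e1, e2]; simp; positivity
      · have h2 : |t - c t| ≤ |t - s| := by
          rw [e1, abs_of_neg (by linarith), abs_of_neg (by linarith)]; linarith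
        calc _ ≤ |t - s| * |t - s| := mul_le_mul h2 (hclip s t) (abs_nonneg _) (abs_nonneg _)
          _ = _ := by rw [abs_mul_abs_self]; ring
    rcases lt_or_ge 1 t with h1 | h1
    · have e1 : c t = 1 := by
        simp only [hc]; rw [min_eq_right h1.le, max_eq_right zero_le_one]
      rcases lt_or_ge 1 s with h2 | h2
      · have e2 : c s = 1 := by
          simp only [hc]; rw [min_eq_right h2.le, max_eq_right zero_le_one]
        rw [e1, e2]; simp; positivity
      · have h2 : |t - c t| ≤ |t - s| := by
          rw [e1, abs_of_pos (by linarith), abs_of_pos (by linarith)]; linarith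
        calc _ ≤ |t - s| * |t - s| := mul_le_mul h2 (hclip s t) (abs_nonneg _) (abs_nonneg _)
          _ = _ := by rw [abs_mul_abs_self]; ring
    · rw [hcid t ⟨h0, h1⟩]; simp; positivity
  refine ⟨fun t => γ (c t) + (t - c t) • σ (c t), fun t => σ (c t), fun t ht => ?_, fun s => ?_, ?_⟩
  · simp only [hcid t ht]; simp
  · refine hasDerivAt_of_quadratic_bound (K := 2 * K) fun t => ?_
    have e : γ (c t) + (t - c t) • σ (c t) - (γ (c s) + (s - c s) • σ (c s)) - (t - s) • σ (c s) =
        (γ (c t) - γ (c s) - (c t - c s) • σ (c s)) + (t - c t) • (σ (c t) - σ (c s)) := by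
      module
    rw [e]
    refine (norm_add_le _ _).trans ?_
    rw [norm_smul, Real.norm_eq_abs]
    have h1 := hγ _ (hcmem s) _ (hcmem t)
    have h2 := mul_le_mul_of_nonneg_left (hσ _ (hcmem s) _ (hcmem t)) (abs_nonneg (t - c t))
    have h3 := mul_le_mul_of_nonneg_left (hcprod s t) hK
    have h4 : (c t - c s) ^ 2 ≤ (t - s) ^ 2 := sq_le_sq.2 (hclip s t)
    nlinarith
  · refine LipschitzWith.of_dist_le_mul fun t s => ?_
    rw [dist_eq_norm, Real.dist_eq, Real.coe_toNNReal _ hK]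
    exact (hσ _ (hcmem s) _ (hcmem t)).trans (mul_le_mul_of_nonneg_left (hclip s t) hK)

end PosReach

/-! ### The curve inside the set and its graph -/

namespace PosReach

section Surface

variable {E : Type*} [NormedAddCommGroup E] [InnerProductSpace ℝ E]

open scoped RealInnerProductSpace

/-- Near a point of `TPlus 1 A`, the set `A` contains a `C^{1,1}` curve which is a graph over the
tangent line. -/
theorem exists_C11_curve [ProperSpace E] {A : Set E} {r : ℝ} (hr : 0 < r)
    (hU : ∀ z, Metric.infDist z A < r → z ∈ unp A) {a e : E} (he : ‖e‖ = 1) (ha : a ∈ A)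
    (hspan : Submodule.span ℝ (tanCone A a) = Submodule.span ℝ {e})
    (hmem : e ∈ tanCone A a) (hmem' : -e ∈ tanCone A a) :
    ∃ (ρ : ℝ) (γ σ : ℝ → E) (K : ℝ≥0), 0 < ρ ∧ (∀ t, HasDerivAt γ (σ t) t) ∧ LipschitzWith K σ ∧
      ∀ s, |s| ≤ ρ → γ s ∈ A ∧ ⟪γ s - a, e⟫ = s ∧ ‖γ s - a‖ ≤ r / 50 := by
  obtain ⟨μ, hμ, hμr, hlevel⟩ := exists_local_level hr hU he ha hspan hmem hmem'
  -- Slice points are within `2 * ρ` of `a` and feet of midpoints within `4 * ρ`, so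
  -- `exists_local_level` applies to all of them.
  set ρ := μ / 10 with hρ
  have hρ0 : 0 < ρ := by positivity
  set F : ℝ → Set E := fun s => {x | x ∈ A ∧ ‖x - a‖ ≤ r / 2 ∧ ⟪x - a, e⟫ = s} with hF
  have hFn : ∀ s, ∀ x ∈ F s, ‖x - a‖ ≤ 2 * |s| := by
    rintro s x ⟨hx, hxa, hxs⟩
    have := norm_sub_le_abs_inner hr hU he ha hx (η := 1 / 2) (by norm_num) (by linarith) hspan
    rw [hxs] at this
    linarith
  have hFc : ∀ s, IsCompact (F s) := fun s => by
    refine (isCompact_closedBall a (r / 2)).of_isClosed_subset ?_ fun x hx => ?_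
    · refine (isClosed_of_unp hr hU).inter (IsClosed.inter ?_ ?_)
      · exact isClosed_le (f := fun x => ‖x - a‖) (by fun_prop) continuous_const
      · exact isClosed_eq (f := fun x => ⟪x - a, e⟫) (by fun_prop) continuous_const
    · rw [mem_closedBall_iff_norm]; exact hx.2.1
  have hFlip : ∀ s t, |s| ≤ ρ → |t| ≤ ρ → ∀ x ∈ F s, ∃ y ∈ F t, ‖y - x‖ ≤ 2 * |t - s| := by
    intro s t hs ht x hx
    have h1 := hFn s x hx
    obtain ⟨q, hq, hqt, hqx⟩ := hlevel x hx.1 (by linarith) t (by linarith)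
    rw [hx.2.2] at hqx
    refine ⟨q, ⟨hq, ?_, hqt⟩, hqx⟩
    have h2 := norm_add_le (q - x) (x - a)
    rw [sub_add_sub_cancel] at h2
    have h3 := abs_sub t s
    linarith
  have hFmid : ∀ s t, |s| ≤ ρ → |t| ≤ ρ → ∀ x ∈ F s, ∀ y ∈ F t,
      ∃ q ∈ F ((s + t) / 2), ‖q - (2⁻¹ : ℝ) • (x + y)‖ ≤ 1 / r * ‖y - x‖ ^ 2 := by
    intro s t hs ht x hx y hy
    have hxn := hFn s x hx
    have hyn := hFn t y hy
    have hyx : ‖y - x‖ ≤ 4 * ρ := by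
      have := norm_sub_le (y - a) (x - a)
      rw [sub_sub_sub_cancel_right] at this
      linarith
    -- The midpoint `m` is projected to `A`, then the foot is moved back to the level of `m`. The
    -- second move costs at most `2 * ‖m - p‖`, and `3 * ‖m - p‖` is still quadratic in `‖y - x‖`.
    obtain ⟨p, hp⟩ := exists_nearest hr hU ⟨a, ha⟩ (x + (2⁻¹ : ℝ) • (y - x))
    have hd := dist_segment_le hr hU (by norm_num) hx.1 hy.1 (by linarith) hp
    have hm : x + (2⁻¹ : ℝ) • (y - x) = (2⁻¹ : ℝ) • (x + y) := by module
    have hmx := (mem_nearestPoints_iff.1 hp).2 x hx.1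
    rw [dist_eq_norm, dist_eq_norm, add_sub_cancel_left, norm_smul, hm] at hmx
    rw [hm] at hd
    set m := (2⁻¹ : ℝ) • (x + y) with hm_def
    have hma : m - a = (2⁻¹ : ℝ) • ((x - a) + (y - a)) := by rw [hm_def]; module
    have hmn : ‖m - a‖ ≤ 2 * ρ := by
      rw [hma, norm_smul]
      have := norm_add_le (x - a) (y - a)
      norm_num
      linarith
    have hmw : ⟪m - a, e⟫ = (s + t) / 2 := by
      rw [hma, real_inner_smul_left, inner_add_left, hx.2.2, hy.2.2]; ring
    have hmp : ‖m - p‖ ≤ 2 * ρ := by norm_num at hmx; linarith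
    have hpa : ‖p - a‖ ≤ 4 * ρ := by
      have := norm_sub_le (m - a) (m - p)
      rw [sub_sub_sub_cancel_left] at this
      linarith
    have hst : |(s + t) / 2| ≤ ρ := by
      rw [abs_le] at hs ht ⊢
      constructor <;> linarith
    obtain ⟨q, hq, hqw, hqp⟩ := hlevel p hp.1 (by linarith) ((s + t) / 2) (by linarith)
    have h1 : |(s + t) / 2 - ⟪p - a, e⟫| ≤ ‖m - p‖ := by
      rw [← hmw, ← inner_sub_left, sub_sub_sub_cancel_right]
      simpa [he] using abs_real_inner_le_norm (m - p) e
    have h2 : ‖q - m‖ ≤ 3 * ‖m - p‖ := by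
      have := norm_sub_le (q - p) (m - p)
      rw [sub_sub_sub_cancel_right] at this
      linarith
    refine ⟨q, ⟨hq, ?_, hqw⟩, ?_⟩
    · have := norm_add_le (q - p) (p - a)
      rw [sub_add_sub_cancel] at this
      linarith
    · rw [one_div, inv_mul_eq_div, le_div_iff₀ hr]
      nlinarith [sq_nonneg ‖y - x‖]
  set θ : ℝ → ℝ := fun t => ρ * (2 * t - 1) with hθ
  have hθmem : ∀ t ∈ Set.Icc (0 : ℝ) 1, |θ t| ≤ ρ := fun t ht => by
    rw [abs_le]; constructor <;> simp only [hθ] <;> nlinarith [ht.1, ht.2]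
  have h0 : a ∈ F 0 := ⟨ha, by rw [sub_self, norm_zero]; positivity, by simp⟩
  obtain ⟨x₀, hx₀, -⟩ := hFlip 0 (θ 0) (by rw [abs_zero]; exact hρ0.le)
    (hθmem 0 (by norm_num)) a h0
  obtain ⟨γ, σ, K, hK, hγF, hγ, hσ⟩ := exists_C11_selection (G := fun t => F (θ t)) (L := 4 * ρ)
    (C := 1 / r) (by positivity) (by positivity) (fun t _ => hFc _) ⟨x₀, hx₀⟩
    (fun s hs t ht x hx => by
      obtain ⟨y, hy, hyx⟩ := hFlip _ _ (hθmem s hs) (hθmem t ht) x hx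
      refine ⟨y, hy, hyx.trans (le_of_eq ?_)⟩
      have : θ t - θ s = 2 * ρ * (t - s) := by simp only [hθ]; ring
      rw [this, abs_mul, abs_of_pos (by positivity)]; ring)
    (fun s hs t ht x hx y hy => by
      obtain ⟨q, hq, hqn⟩ := hFmid _ _ (hθmem s hs) (hθmem t ht) x hx y hy
      have : (θ s + θ t) / 2 = θ ((s + t) / 2) := by simp only [hθ]; ring
      rw [this] at hq
      exact ⟨q, hq, hqn⟩)
  obtain ⟨γ', σ', heq, hder, hlip⟩ := exists_C11_extension hK hγ hσ
  set ψ : ℝ → ℝ := fun s => (2 * ρ)⁻¹ * s + 2⁻¹ with hψ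
  have hψlip : LipschitzWith (Real.nnabs (2 * ρ)⁻¹) ψ := by
    refine LipschitzWith.of_dist_le_mul fun x y => le_of_eq ?_
    rw [Real.dist_eq, Real.dist_eq, Real.coe_nnabs, ← abs_mul]
    congr 1; simp only [hψ]; ring
  refine ⟨ρ, γ' ∘ ψ, fun s => (2 * ρ)⁻¹ • σ' (ψ s), _, hρ0, fun s => ?_,
    ((lipschitzWith_smul ((2 * ρ)⁻¹ : ℝ)).comp (hlip.comp hψlip)), fun s hs => ?_⟩
  · have h1 : HasDerivAt ψ (2 * ρ)⁻¹ s := by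
      have := ((hasDerivAt_id s).const_mul (2 * ρ)⁻¹).add_const (2⁻¹ : ℝ)
      rwa [mul_one] at this
    exact (hder (ψ s)).scomp s h1
  · have hψs : ψ s ∈ Set.Icc (0 : ℝ) 1 := by
      have h1 : ψ s = (s + ρ) / (2 * ρ) := by simp only [hψ]; field_simp
      rw [abs_le] at hs
      rw [h1]
      exact ⟨div_nonneg (by linarith) (by positivity), (div_le_one (by positivity)).2 (by linarith)⟩
    have hθψ : θ (ψ s) = s := by simp only [hθ, hψ]; field_simp; ring
    have h1 : γ (ψ s) ∈ F (θ (ψ s)) := hγF _ hψs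
    rw [hθψ] at h1
    rw [Function.comp, heq _ hψs]
    exact ⟨h1.1, h1.2.2, (hFn s _ h1).trans (by linarith)⟩

open Submodule in
/-- The graph over a line `ℝ e` obtained from the component orthogonal to `e` of a `C^{1,1}` curve
is a `C^{1,1}` surface. -/
theorem isC11Surface_graph_of_curve [FiniteDimensional ℝ E] (hd : 1 < Module.finrank ℝ E) {e : E}
    (he : ‖e‖ = 1) {γ σ : ℝ → E} {K : ℝ≥0} (hγ : ∀ t, HasDerivAt γ (σ t) t)
    (hσ : LipschitzWith K σ) (c : ℝ) :
    IsC11Surface 1 {x : E | x - ⟪x, e⟫ • e = γ (⟪x, e⟫ - c) - ⟪γ (⟪x, e⟫ - c), e⟫ • e} := by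
  have he0 : e ≠ 0 := fun h => by simp [h] at he
  set W : Submodule ℝ E := ℝ ∙ e with hW
  set P : E →L[ℝ] Wᗮ := Wᗮ.orthogonalProjectionOnto with hP
  have hPv : ∀ v, (P v : E) = v - ⟪v, e⟫ • e := fun v => by
    have h1 := starProjection_add_starProjection_orthogonal (K := W) v
    have h2 : W.starProjection v = ⟪e, v⟫ • e := starProjection_unit_singleton ℝ he v
    rw [h2, starProjection_apply] at h1
    rw [real_inner_comm]
    exact eq_sub_of_add_eq' h1
  set ℓ : W →L[ℝ] ℝ := (innerSL ℝ e).comp W.subtypeL with hℓ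
  have hℓw : ∀ w : W, ℓ w = ⟪(w : E), e⟫ := fun w => by rw [real_inner_comm]; rfl
  have hWw : ∀ w : W, (w : E) = ⟪(w : E), e⟫ • e := fun w => by
    obtain ⟨k, hk⟩ := mem_span_singleton.1 w.2
    rw [← hk, real_inner_smul_left, real_inner_self_eq_norm_sq, he]; norm_num
  have hperp : ∀ v : Wᗮ, ⟪(v : E), e⟫ = 0 := fun v =>
    (mem_orthogonal_singleton_iff_inner_left).1 v.2
  -- The derivative of the graph map depends linearly on the velocity, so it inherits the Lipschitz
  -- property of `σ`.
  set Λ : E → W →L[ℝ] Wᗮ := fun v => ℓ.smulRight (P v) with hΛ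
  have hder : ∀ w : W, HasFDerivAt (fun w : W => P (γ (ℓ w - c))) (Λ (σ (ℓ w - c))) w := fun w => by
    have h1 : HasFDerivAt (fun w : W => ℓ w - c) ℓ w := ℓ.hasFDerivAt.sub_const c
    have h2 := (P.hasFDerivAt.comp w ((hγ (ℓ w - c)).hasFDerivAt.comp w h1))
    refine h2.congr_fderiv ?_
    ext v
    simp [hΛ]
  refine ⟨one_pos, hd, W, fun w => P (γ (ℓ w - c)), finrank_span_singleton he0,
    ⟨fun w => (hder w).differentiableAt, ?_⟩, ?_⟩
  · have h1 : fderiv ℝ (fun w : W => P (γ (ℓ w - c))) = Λ ∘ σ ∘ fun w => ℓ w - c :=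
      funext fun w => (hder w).fderiv
    rw [h1]
    have hΛl : LipschitzWith (‖ℓ‖₊ * ‖P‖₊) Λ := LipschitzWith.of_dist_le_mul fun u v => by
      have h2 : Λ u - Λ v = ℓ.smulRight (P (u - v)) := by
        ext w; simp [hΛ, smul_sub]
      rw [dist_eq_norm, dist_eq_norm, h2, ContinuousLinearMap.norm_smulRight_apply, NNReal.coe_mul,
        coe_nnnorm, coe_nnnorm, mul_assoc]
      exact mul_le_mul_of_nonneg_left (P.le_opNorm _) (norm_nonneg _)
    exact ⟨_, hΛl.comp (hσ.comp (ℓ.lipschitz.sub (LipschitzWith.const c)))⟩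
  · ext x
    constructor
    · intro hx
      have hxe : ⟪⟪x, e⟫ • e, e⟫ = ⟪x, e⟫ := by
        rw [real_inner_smul_left, real_inner_self_eq_norm_sq, he]; norm_num
      refine ⟨⟨⟪x, e⟫ • e, smul_mem _ _ (mem_span_singleton_self e)⟩, ?_⟩
      rw [hPv, hℓw]
      simp only [hxe]
      rw [← show x - ⟪x, e⟫ • e = _ from hx]; abel
    · rintro ⟨w, hw⟩
      have h1 : ⟪x, e⟫ = ⟪(w : E), e⟫ := by rw [hw, inner_add_left, hperp, add_zero]
      change x - ⟪x, e⟫ • e = _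
      rw [h1, ← hWw, ← hℓw, ← hPv, hw]; abel

end Surface

end PosReach

/-! ### The theorem -/

open PosReach in
open scoped RealInnerProductSpace in
theorem theorem4p3 (d : ℕ) (hd : 2 ≤ d) (A : Set (EuclideanSpace ℝ (Fin d)))
    (hA : PosReach.HasPositiveReach A) (a : EuclideanSpace ℝ (Fin d))
    (ha : a ∈ PosReach.TPlus 1 A) :
    ∃ Γ : Set (EuclideanSpace ℝ (Fin d)), PosReach.IsC11Surface 1 Γ ∧
      ∃ δ : ℝ, 0 < δ ∧
        PosReach.T 1 A ∩ Metric.ball a δ ⊆ Γ ∩ Metric.ball a δ ∧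
        Γ ∩ Metric.ball a δ ⊆ A := by
  obtain ⟨hT, hline⟩ := ha
  obtain ⟨r, hr, hU⟩ := hA.exists_radius ⟨a, hT.1⟩
  obtain ⟨e, he, hspan⟩ := exists_unit_span_of_mem_T hT
  have hmul : ∀ c : ℝ, c • e ∈ tanCone A a := fun c => by
    rw [← hline, hspan]
    exact Submodule.smul_mem _ _ (Submodule.mem_span_singleton_self e)
  have hmem : e ∈ tanCone A a := by simpa using hmul 1
  have hmem' : -e ∈ tanCone A a := by simpa using hmul (-1)
  obtain ⟨ρ, γ, σ, K, hρ, hγ, hσ, hcurve⟩ := exists_C11_curve hr hU he hT.1 hspan hmem hmem'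
  obtain ⟨ν, hν, huniq⟩ := exists_fibre_unique hr hU he hT.1 hspan hmem
  have key : ∀ x : EuclideanSpace ℝ (Fin d), ‖x - a‖ < ρ →
      γ (⟪x, e⟫ - ⟪a, e⟫) ∈ A ∧ ⟪γ (⟪x, e⟫ - ⟪a, e⟫), e⟫ = ⟪x, e⟫ ∧
        ‖γ (⟪x, e⟫ - ⟪a, e⟫) - a‖ ≤ r / 50 := fun x hx => by
    have h1 : |⟪x, e⟫ - ⟪a, e⟫| ≤ ‖x - a‖ := by
      rw [← inner_sub_left]; simpa [he] using abs_real_inner_le_norm (x - a) e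
    obtain ⟨h2, h3, h4⟩ := hcurve _ (h1.trans hx.le)
    rw [inner_sub_left] at h3
    exact ⟨h2, by linarith, h4⟩
  -- The radius `ρ` puts the curve in `A`, and `ν` gives uniqueness in the slice. The bound `r / 50`
  -- keeps `x` and the curve point within `r / 10` of each other, as that uniqueness requires.
  refine ⟨_, isC11Surface_graph_of_curve ?_ he hγ hσ ⟪a, e⟫, min ρ (min ν (r / 50)),
    lt_min hρ (lt_min hν (by positivity)), ?_, ?_⟩
  · rw [finrank_euclideanSpace_fin]; omega
  · rintro x ⟨hxT, hx⟩
    refine ⟨?_, hx⟩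
    rw [mem_ball_iff_norm, lt_min_iff, lt_min_iff] at hx
    obtain ⟨h1, h2, h3⟩ := key x hx.1
    have h4 := huniq x hxT hx.2.1.le _ h1 (by
      have := norm_sub_le (γ (⟪x, e⟫ - ⟪a, e⟫) - a) (x - a)
      rw [sub_sub_sub_cancel_right] at this
      linarith [hx.2.2]) (by rw [inner_sub_left, h2, sub_self])
    change x - ⟪x, e⟫ • e = _
    rw [h4]
  · rintro x ⟨hxΓ, hx⟩
    rw [mem_ball_iff_norm, lt_min_iff] at hx
    obtain ⟨h1, h2, -⟩ := key x hx.1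
    replace hxΓ : x - ⟪x, e⟫ • e = _ := hxΓ
    -- The curve point has the same height as `x`, so equal orthogonal components make the two
    -- points coincide.
    rw [h2] at hxΓ
    rw [sub_left_injective hxΓ]
    exact h1
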